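/- **Setting.** Let $\Bbbk$ be a field and $H$ a finite-dimensional Hopf algebra over $\Bbbk$ with coproduct $\Delta$, $\Delta(h)=h_{(1)}\otimes h_{(2)}$, counit $\varepsilon$ and (automatically bijective) antipode $S$. All algebras are associative and unital; $\Sigma$ denotes tensor flips. * $\hat H$ is the dual Hopf algebra: $(\theta\theta')(h)=\theta(h_{(1)})\theta'(h_{(2)})$, and $\hat\Delta(\theta)=\theta_{(1)}\otimes\theta_{(2)}$ is determined by $\theta_{(1)}(h)\theta_{(2)}(h')=\theta(hh')$. $H^{\rm op}$ is $H$ with the opposite product and the same coproduct. * ${}^{\circ}U=\sum_i h_i^{\rm op}\otimes \hat h_i\in H^{\rm op}\otimes\hat H$, for a basis $(h_i)$ of $H$ with dual basis $(\hat h_i)$. It is invertible, and $\mathrm{Ad}({}^{\circ}U)(z)={}^{\circ}U\,z\,({}^{\circ}U)^{-1}$. * $\mathcal T_R(H)=H^{\rm op}\otimes\hat H$, with the tensor product algebra structure, the counit $\varepsilon\otimes\hat\varepsilon$ and the coproduct $(\mathrm{id}\otimes\Sigma\,\mathrm{Ad}({}^{\circ}U)\otimes\mathrm{id})(\Delta\otimes\hat\Delta)$.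 * $\mathcal D_R(H)$ is the dual of $\mathcal T_R(H)$ (product dual to the coproduct, coproduct dual to the product). It is identified with $\hat H\otimes H$ as a vector space, writing $\omega\bowtie h$ for the element with $\langle\omega\bowtie h,\,c^{\rm op}\otimes\theta\rangle=\omega(c)\theta(h)$. For $B$ one of these, a left coaction of $B$ on an algebra $X$ is an algebra homomorphism $\alpha:X\to B\otimes X$ with $(\mathrm{id}\otimes\alpha)\alpha=(\Delta_B\otimes\mathrm{id})\alpha$ and $(\varepsilon_B\otimes\mathrm{id})\alpha=\mathrm{id}$. A right $B$-module algebra is an algebra $X$ with a right $B$-module structure such that $(xy)\lhd b=(x\lhd b_{(1)})(y\lhd b_{(2)})$ and $1\lhd b=\varepsilon_B(b)1$. Consider the following categories, whose morphisms are the algebra homomorphisms that are compatible with all the given actions and coactions: * $\mathfrak{YD}^{ll}(H,\hat H)$ (left-left Yetter–Drinfeld algebras): algebras $X$ with left coactions $\alpha:X\to H^{\rm op}\otimes X$ and $\beta:X\to\hat H\otimes X$ such that $(\mathrm{id}\otimes\alpha)\beta=(\Sigma\otimes\mathrm{id})(\mathrm{Ad}({}^{\circ}U)\otimes\mathrm{id})(\mathrm{id}\otimes\beta)\alpha$;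 * ${}^{\mathcal T_R(H)}\mathfrak{Alg}$: algebras $X$ with a left coaction $\gamma$ of $\mathcal T_R(H)$; * ${}^{H}\mathfrak{YD}_{H}$ (right-left Yetter–Drinfeld algebras): right $H$-module algebras $(X,\lhd)$ with a left coaction $\alpha:X\to H^{\rm op}\otimes X$, $\alpha(x)=x_{[-1]}^{\rm op}\otimes x_{[0]}$, such that $x_{[-1]}h_{(1)}\otimes(x_{[0]}\lhd h_{(2)})=h_{(2)}(x\lhd h_{(1)})_{[-1]}\otimes(x\lhd h_{(1)})_{[0]}$ in $H\otimes X$ for all $x\in X$, $h\in H$; * $\mathfrak{Alg}_{\mathcal D_R(H)}$: right $\mathcal D_R(H)$-module algebras. **Proposition.** The assignment $$\mathfrak E'_R:\ \mathfrak{YD}^{ll}(H,\hat H)\to{}^{\mathcal T_R(H)}\mathfrak{Alg},\qquad (X,\alpha,\beta)\mapsto\bigl(X,\ \gamma=(\mathrm{id}\otimes\beta)\alpha\bigr),\quad f\mapsto f,$$ is a well-defined functor and an equivalence of categories. Moreover the following are well-defined functors (each being $f\mapsto f$ on morphisms) and equivalences of categories: * $\mathfrak{YD}^{ll}(H,\hat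 H)\to{}^{H}\mathfrak{YD}_{H}$, $(X,\alpha,\beta)\mapsto(X,\lhd_\beta,\alpha)$, where $x\lhd_\beta h=(\langle h,\cdot\rangle\otimes\mathrm{id})(\beta(x))$ and $\langle h,\theta\rangle=\theta(h)$; * ${}^{\mathcal T_R(H)}\mathfrak{Alg}\to\mathfrak{Alg}_{\mathcal D_R(H)}$, $(X,\gamma)\mapsto(X,\lhd_\gamma)$, where $x\lhd_\gamma d=(\langle d,\cdot\rangle\otimes\mathrm{id})(\gamma(x))$; * $\mathfrak E_R:{}^{H}\mathfrak{YD}_{H}\to\mathfrak{Alg}_{\mathcal D_R(H)}$, $(X,\lhd,\alpha)\mapsto(X,\cdot)$, where $x\cdot(\omega\bowtie h)=(\omega(x_{[-1]})\,x_{[0]})\lhd h$. These four functors form a commutative square: the composite $(X,\alpha,\beta)\mapsto\mathfrak E_R(X,\lhd_\beta,\alpha)$ equals the composite $(X,\alpha,\beta)\mapsto(X,\lhd_\gamma)$ with $\gamma=(\mathrm{id}\otimes\beta)\alpha$. -/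

import Mathlib

universe u v w

namespace DY
open scoped TensorProduct
open Coalgebra HopfAlgebra WithConv
section Antipode
variable {k : Type*} [Field k]

theorem conv_comp_algHom {A B C : Type*} [Ring A] [Algebra k A] [Ring B] [Algebra k B]
    [AddCommGroup C] [Module k C] [Coalgebra k C] (h : A →ₐ[k] B) {f g : C →ₗ[k] A}
    (e : toConv f * toConv g = 1) :
    toConv (h.toLinearMap ∘ₗ f) * toConv (h.toLinearMap ∘ₗ g) = 1 := by
  have := LinearMap.algHom_comp_convMul_distrib (R := k) (C := C) h (toConv f) (toConv g)
  apply WithConv.ext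
  rw [← this, e]
  ext; simp [LinearMap.convOne_def]

theorem conv_comp_coalg {A C : Type*} [Ring A] [Algebra k A]
    [AddCommGroup C] [Module k C] [Coalgebra k C] {π : C →ₗ[k] C}
    (hΔ : comul ∘ₗ π = TensorProduct.map π π ∘ₗ comul) {f g h : C →ₗ[k] A}
    (e : toConv f * toConv g = toConv h) :
    toConv (f ∘ₗ π) * toConv (g ∘ₗ π) = toConv (h ∘ₗ π) := by
  apply WithConv.ext
  have := congrArg (fun z => z.ofConv ∘ₗ π) e
  simp only [LinearMap.convMul_def, ofConv_toConv] at this ⊢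
  rw [← this, LinearMap.comp_assoc, LinearMap.comp_assoc, hΔ, TensorProduct.map_comp,
    LinearMap.comp_assoc]

variable {H : Type*} [Ring H] [HopfAlgebra k H]


theorem conv_incl (f g : H →ₗ[k] H) : toConv (AlgHom.toLinearMap (Algebra.TensorProduct.includeLeft : H →ₐ[k] H ⊗[k] H) ∘ₗ f) * toConv (AlgHom.toLinearMap (Algebra.TensorProduct.includeRight : H →ₐ[k] H ⊗[k] H) ∘ₗ g) =
    toConv (TensorProduct.map f g ∘ₗ comul) := by
  apply WithConv.ext
  simp only [LinearMap.convMul_def, ofConv_toConv]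
  rw [← LinearMap.comp_assoc]
  congr 1
  ext; simp

theorem conv_incl' (f g : H →ₗ[k] H) : toConv (AlgHom.toLinearMap (Algebra.TensorProduct.includeRight : H →ₐ[k] H ⊗[k] H) ∘ₗ f) * toConv (AlgHom.toLinearMap (Algebra.TensorProduct.includeLeft : H →ₐ[k] H ⊗[k] H) ∘ₗ g) =
    toConv (TensorProduct.map g f ∘ₗ (TensorProduct.comm k H H).toLinearMap ∘ₗ comul) := by
  apply WithConv.ext
  simp only [LinearMap.convMul_def, ofConv_toConv]
  rw [← LinearMap.comp_assoc, ← LinearMap.comp_assoc]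
  congr 1
  ext; simp

theorem comul_antipode :
    comul ∘ₗ antipode k (A := H) = TensorProduct.map (antipode k) (antipode k) ∘ₗ
      (TensorProduct.comm k H H).toLinearMap ∘ₗ comul := by
  have h1 := conv_comp_algHom (k := k) (Algebra.TensorProduct.includeLeft : H →ₐ[k] H ⊗[k] H) (LinearMap.id_mul_antipode (R := k) (C := H))
  have h2 := conv_comp_algHom (k := k) (Algebra.TensorProduct.includeRight : H →ₐ[k] H ⊗[k] H) (LinearMap.id_mul_antipode (R := k) (C := H))
  have h3 := conv_comp_algHom (k := k) (Bialgebra.comulAlgHom k H) (LinearMap.antipode_mul_id (R := k) (C := H))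
  have h4 := conv_incl (k := k) (H := H) LinearMap.id LinearMap.id
  have h5 := conv_incl' (k := k) (H := H) (antipode k) (antipode k)
  apply toConv_injective
  rw [← h5]
  refine left_inv_eq_right_inv (a := toConv (comul : H →ₗ[k] H ⊗[k] H)) h3 ?_
  simp only [TensorProduct.map_id, LinearMap.id_comp] at h4
  rw [← h4]
  rw [mul_assoc, ← mul_assoc (toConv (AlgHom.toLinearMap (Algebra.TensorProduct.includeRight : H →ₐ[k] H ⊗[k] H) ∘ₗ LinearMap.id)), h2, one_mul, h1]

theorem comul_sq {φ ψ : H →ₗ[k] H} (h1 : comul ∘ₗ φ = TensorProduct.map φ φ ∘ₗ comul)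
    (h2 : comul ∘ₗ ψ = TensorProduct.map ψ ψ ∘ₗ comul) :
    comul ∘ₗ (φ ∘ₗ ψ) = TensorProduct.map (φ ∘ₗ ψ) (φ ∘ₗ ψ) ∘ₗ comul := by
  rw [TensorProduct.map_comp, LinearMap.comp_assoc, ← h2, ← LinearMap.comp_assoc, h1,
    LinearMap.comp_assoc]

theorem comul_antipode_sq :
    comul ∘ₗ (antipode k ∘ₗ antipode k (A := H)) =
      TensorProduct.map (antipode k ∘ₗ antipode k) (antipode k ∘ₗ antipode k) ∘ₗ comul := by
  rw [← LinearMap.comp_assoc, comul_antipode, LinearMap.comp_assoc, LinearMap.comp_assoc, comul_antipode,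
    TensorProduct.map_comp, LinearMap.comp_assoc]
  congr 1
  have : (TensorProduct.comm k H H).toLinearMap ∘ₗ TensorProduct.map (antipode k (A := H)) (antipode k (A := H))
    = TensorProduct.map (antipode k) (antipode k) ∘ₗ (TensorProduct.comm k H H).toLinearMap := by
    ext; simp
  rw [← LinearMap.comp_assoc, this, LinearMap.comp_assoc]
  congr 1
  ext x; simp

/-- one step of the descent -/
theorem coinv_step (m : H ⊗[k] H →ₗ[k] H) (hm : ∀ a, m (a ⊗ₜ 1) = a) {f g : H →ₗ[k] H}
    (e : m ∘ₗ TensorProduct.map f g ∘ₗ comul = Algebra.linearMap k H ∘ₗ counit) {h : H}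
    (hg : TensorProduct.map LinearMap.id g (comul h) = h ⊗ₜ[k] 1) :
    TensorProduct.map LinearMap.id f (comul h) = h ⊗ₜ[k] 1 := by
  have h1 := congrArg (fun z => TensorProduct.map LinearMap.id (m ∘ₗ TensorProduct.map f LinearMap.id)
    (TensorProduct.assoc k H H H (TensorProduct.map comul LinearMap.id z))) hg
  have h2 : ∀ z : H ⊗[k] H, TensorProduct.map comul LinearMap.id (TensorProduct.map LinearMap.id g z) =
     TensorProduct.map LinearMap.id g (TensorProduct.map (comul (R := k) (A := H)) LinearMap.id z) := by
    intro z; simp [TensorProduct.map_map]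
  have h3 : ∀ z : (H ⊗[k] H) ⊗[k] H, TensorProduct.assoc k H H H (TensorProduct.map LinearMap.id g z) =
     TensorProduct.map LinearMap.id (TensorProduct.map LinearMap.id g) (TensorProduct.assoc k H H H z) := by
    intro z
    have : (TensorProduct.assoc k H H H).toLinearMap ∘ₗ TensorProduct.map LinearMap.id g =
      TensorProduct.map LinearMap.id (TensorProduct.map LinearMap.id g) ∘ₗ
        (TensorProduct.assoc k H H H).toLinearMap := by ext; simp
    exact LinearMap.congr_fun this z
  have h4 := Coalgebra.coassoc_apply (R := k) h
  simp only [h2, h3] at h1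
  simp only [LinearMap.rTensor, LinearMap.lTensor] at h4
  rw [h4] at h1
  have e' : m ∘ₗ TensorProduct.map f LinearMap.id ∘ₗ TensorProduct.map LinearMap.id g ∘ₗ comul =
      Algebra.linearMap k H ∘ₗ counit := by
    rw [← e]
    congr 1
    rw [← LinearMap.comp_assoc, ← TensorProduct.map_comp]
    simp
  simp only [TensorProduct.map_map, LinearMap.comp_assoc, LinearMap.comp_id] at h1
  rw [e'] at h1
  have h5 : ∀ z : H ⊗[k] H, TensorProduct.map (LinearMap.id : H →ₗ[k] H) (Algebra.linearMap k H ∘ₗ counit) z =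
     (TensorProduct.rid k H (TensorProduct.map LinearMap.id (counit (R := k)) z)) ⊗ₜ[k] 1 := by
    intro z
    induction z with
    | zero => simp
    | add a b ha hb => simp only [map_add, ha, hb, TensorProduct.add_tmul]
    | tmul a b => simp [Algebra.algebraMap_eq_smul_one, TensorProduct.smul_tmul]
  have h6 := Coalgebra.lTensor_counit_comul (R := k) h
  simp only [LinearMap.lTensor] at h6
  rw [h5, h6] at h1
  simp only [TensorProduct.rid_tmul, one_smul] at h1
  rw [h1]
  simp only [TensorProduct.map_tmul, LinearMap.id_apply]
  generalize (comul (R := k) h) = z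
  induction z with
  | zero => simp
  | add a b ha hb => simp [ha, hb, TensorProduct.add_tmul]
  | tmul a b => simp [hm]

theorem antipode_sq_pow (n : ℕ) :
    ((antipode k ∘ₗ antipode k (A := H)) ^ n) 1 = 1 ∧
    (∀ x y, ((antipode k ∘ₗ antipode k (A := H)) ^ n) (x * y) =
      ((antipode k ∘ₗ antipode k (A := H)) ^ n) x * ((antipode k ∘ₗ antipode k (A := H)) ^ n) y) ∧
    (comul ∘ₗ ((antipode k ∘ₗ antipode k (A := H)) ^ n) =
      TensorProduct.map ((antipode k ∘ₗ antipode k (A := H)) ^ n)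
        ((antipode k ∘ₗ antipode k (A := H)) ^ n) ∘ₗ comul) ∧
    (∀ x, counit (R := k) (((antipode k ∘ₗ antipode k (A := H)) ^ n) x) = counit x) := by
  induction n with
  | zero => simp [Module.End.one_eq_id]
  | succ n ih =>
    obtain ⟨h1, h2, h3, h4⟩ := ih
    have e : ∀ x, ((antipode k ∘ₗ antipode k (A := H)) ^ (n + 1)) x =
        antipode k (antipode k (((antipode k ∘ₗ antipode k (A := H)) ^ n) x)) := by
      intro x; rw [pow_succ', Module.End.mul_apply]; rfl
    refine ⟨?_, ?_, ?_, ?_⟩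
    · rw [e, h1, antipode_one, antipode_one]
    · intro x y; rw [e, e, e, h2, antipode_mul_antidistrib, antipode_mul_antidistrib]
    · rw [pow_succ', Module.End.mul_eq_comp]
      exact comul_sq comul_antipode_sq h3
    · intro x; rw [e, counit_antipode, counit_antipode, h4]

theorem coinv_descent {h : H} (n : ℕ)
    (hn : TensorProduct.map LinearMap.id ((antipode k ∘ₗ antipode k (A := H)) ^ n) (comul (R := k) h) = h ⊗ₜ[k] 1) :
    h = counit (R := k) h • (1 : H) := by
  have hS : ∀ x : H, LinearMap.mul' k H (TensorProduct.map LinearMap.id (antipode k) (comul x)) =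
      algebraMap k H (counit x) := fun x => HopfAlgebra.mul_antipode_lTensor_comul_apply x
  induction n with
  | zero =>
    rw [pow_zero] at hn
    have h1 := Coalgebra.rTensor_counit_comul (R := k) h
    have : comul h = h ⊗ₜ[k] (1 : H) := by rw [← hn]; simp [Module.End.one_eq_id]
    rw [this] at h1
    simpa using (congrArg (TensorProduct.lid k H) h1).symm
  | succ n ih =>
    apply ih
    set φ := (antipode k ∘ₗ antipode k (A := H))
    obtain ⟨-, -, hψ, key2⟩ := antipode_sq_pow (k := k) (H := H) n
    change ∀ x, counit ((φ ^ n) x) = _ at key2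
    have key : ∀ x, TensorProduct.map (φ ^ n) (φ ^ n) (comul x) = comul ((φ ^ n) x) :=
      fun x => (LinearMap.congr_fun hψ x).symm
    have step1 : TensorProduct.map LinearMap.id (antipode k ∘ₗ (φ ^ n)) (comul h) = h ⊗ₜ[k] 1 := by
      refine coinv_step (LinearMap.mul' k H ∘ₗ (TensorProduct.comm k H H).toLinearMap)
        (by intro a; simp) (g := φ ^ (n + 1)) ?_ hn
      have e1 : (LinearMap.mul' k H ∘ₗ (TensorProduct.comm k H H).toLinearMap) ∘ₗ
          TensorProduct.map (antipode k ∘ₗ (φ ^ n)) (φ ^ (n + 1)) =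
          antipode k ∘ₗ LinearMap.mul' k H ∘ₗ TensorProduct.map LinearMap.id (antipode k) ∘ₗ
            TensorProduct.map (φ ^ n) (φ ^ n) := by
        ext a b
        simp [φ, pow_succ', antipode_mul_antidistrib]
      rw [← LinearMap.comp_assoc, e1]
      ext x
      simp only [LinearMap.comp_apply, key, hS, key2]
      simp [Algebra.algebraMap_eq_smul_one]
    refine coinv_step (LinearMap.mul' k H) (by simp) (g := antipode k ∘ₗ (φ ^ n)) ?_ step1
    have e1 : (LinearMap.mul' k H) ∘ₗ TensorProduct.map (φ ^ n) (antipode k ∘ₗ (φ ^ n)) =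
          LinearMap.mul' k H ∘ₗ TensorProduct.map LinearMap.id (antipode k) ∘ₗ
            TensorProduct.map (φ ^ n) (φ ^ n) := by
      ext a b; simp
    rw [← LinearMap.comp_assoc, e1]
    ext x
    simp only [LinearMap.comp_apply, key, hS, key2]
    simp

theorem exists_drazin {V : Type*} [AddCommGroup V] [Module k V] [FiniteDimensional k V]
    (φ : Module.End k V) : ∃ (n : ℕ) (g : V →ₗ[k] V), 1 ≤ n ∧ g ∘ₗ (φ ^ n) = (φ ^ n) ∘ₗ g ∧
      (φ ^ n) ∘ₗ g ∘ₗ (φ ^ n) = φ ^ n := by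
  obtain ⟨n, hn, h1⟩ := ((LinearMap.eventually_isCompl_ker_pow_range_pow φ).and
    (Filter.eventually_ge_atTop 1)).exists
  refine ⟨n, ?_⟩
  set ψ := φ ^ n
  have hinj : Function.Injective (ψ.domRestrict (LinearMap.range ψ)) := by
    rw [← LinearMap.ker_eq_bot, LinearMap.ker_eq_bot']
    rintro ⟨x, hx⟩ h
    have : x ∈ LinearMap.ker ψ ⊓ LinearMap.range ψ := ⟨h, hx⟩
    rw [hn.inf_eq_bot] at this
    exact Subtype.ext this
  let σ : LinearMap.range ψ →ₗ[k] LinearMap.range ψ :=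
    (ψ.domRestrict (LinearMap.range ψ)).codRestrict _ (fun x => ⟨x, rfl⟩)
  have hσ : Function.Injective σ := fun a b h => hinj (congrArg Subtype.val h)
  let e := LinearEquiv.ofInjectiveEndo σ hσ
  have he : ∀ r : LinearMap.range ψ, ((e r : LinearMap.range ψ) : V) = ψ r := fun r => rfl
  have hrng : ∀ r : LinearMap.range ψ, ψ (e.symm r : V) = r := fun r => by
    rw [← he, LinearEquiv.apply_symm_apply]
  obtain ⟨p, hp⟩ : ∃ p : V →ₗ[k] LinearMap.range ψ,
      (∀ r : LinearMap.range ψ, p r = r) ∧ (∀ x ∈ LinearMap.ker ψ, p x = 0) :=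
    ⟨Submodule.projectionOnto _ _ hn.symm, fun r => Submodule.projectionOnto_apply_left hn.symm r,
      fun x hx => (Submodule.projectionOnto_apply_eq_zero_iff hn.symm).2 hx⟩
  have hpψ : ∀ x, ψ (p x) = ψ x := by
    intro x
    have hx : x ∈ LinearMap.ker ψ ⊔ LinearMap.range ψ := by rw [hn.sup_eq_top]; trivial
    obtain ⟨a, ha, b, hb, rfl⟩ := Submodule.mem_sup.1 hx
    rw [map_add, hp.2 a ha, zero_add, map_add, LinearMap.mem_ker.1 ha, zero_add, hp.1 ⟨b, hb⟩]
  refine ⟨(LinearMap.range ψ).subtype ∘ₗ e.symm.toLinearMap ∘ₗ p, h1, ?_, ?_⟩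
  · ext x
    simp only [LinearMap.comp_apply, LinearEquiv.coe_coe, Submodule.subtype_apply, hrng]
    have : p (ψ x) = e (p x) := by
      rw [hp.1 ⟨ψ x, ⟨x, rfl⟩⟩]
      exact Subtype.ext (hpψ x).symm
    rw [this, LinearEquiv.symm_apply_apply]
  · ext x
    simp only [LinearMap.comp_apply, LinearEquiv.coe_coe, Submodule.subtype_apply, hrng]
    rw [hp.1 ⟨ψ x, ⟨x, rfl⟩⟩]

theorem antipode_bijective [FiniteDimensional k H] : Function.Bijective (antipode k (A := H)) := by
  set φ : Module.End k H := (antipode k ∘ₗ antipode k (A := H)) with hφ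
  obtain ⟨n, g, hn, hg, hg'⟩ := exists_drazin φ
  obtain ⟨ψ_one, ψ_mul, ψ_comul, ψ_counit⟩ := antipode_sq_pow (k := k) (H := H) n
  rw [← hφ] at ψ_one ψ_mul ψ_comul ψ_counit
  obtain ⟨ψ, hψ_def⟩ : ∃ ψ, ψ = φ ^ n := ⟨_, rfl⟩
  rw [← hψ_def] at ψ_one ψ_mul ψ_comul ψ_counit hg hg'
  obtain ⟨π, hπ⟩ : ∃ π, π = g ∘ₗ ψ := ⟨_, rfl⟩
  rw [← hπ] at hg hg'
  have πψ : π ∘ₗ ψ = ψ := by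
    rw [hg, LinearMap.comp_assoc, ← hπ, hg']
  have ππ : π ∘ₗ π = π := by
    conv_lhs => rw [hπ]
    rw [LinearMap.comp_assoc, ← hπ, hg', hπ]
  have πa : ∀ x, π x = ψ (g x) := LinearMap.congr_fun hg
  have πa' : ∀ x, π x = g (ψ x) := fun _ => by rw [hπ]; rfl
  have πψa : ∀ x, π (ψ x) = ψ x := LinearMap.congr_fun πψ
  have ψπa : ∀ x, ψ (π x) = ψ x := LinearMap.congr_fun hg'
  have π_one : π 1 = 1 := by rw [← ψ_one, πψa]
  have π_mul : ∀ x y, π (x * y) = π x * π y := by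
    intro x y
    have : π x * π y = ψ (g x * g y) := by rw [ψ_mul, πa, πa]
    rw [this, ← πψa, ← this, πa' (π x * π y), ψ_mul (π x), ψπa, ψπa, ← ψ_mul, ← πa']
  have π_comul : comul ∘ₗ π = TensorProduct.map π π ∘ₗ comul := by
    have e1 : comul ∘ₗ π = TensorProduct.map π π ∘ₗ comul ∘ₗ π := by
      have e2 : comul ∘ₗ π = TensorProduct.map ψ ψ ∘ₗ comul ∘ₗ g := by
        rw [hg, ← LinearMap.comp_assoc, ψ_comul, LinearMap.comp_assoc]
      rw [e2, ← LinearMap.comp_assoc _ _ (TensorProduct.map π π), ← TensorProduct.map_comp, πψ]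
    have e3 : TensorProduct.map π π = TensorProduct.map g g ∘ₗ TensorProduct.map ψ ψ := by
      rw [← TensorProduct.map_comp, ← hπ]
    rw [e1]
    conv_lhs => rw [e3]
    conv_rhs => rw [e3]
    rw [LinearMap.comp_assoc, ← LinearMap.comp_assoc _ _ (TensorProduct.map ψ ψ), ← ψ_comul,
      LinearMap.comp_assoc, hg', LinearMap.comp_assoc, ← ψ_comul]
  let πA : H →ₐ[k] H := AlgHom.ofLinearMap π π_one π_mul
  have π_counit : (counit : H →ₗ[k] k) ∘ₗ π = counit := by
    ext x; simp only [LinearMap.comp_apply]; rw [← ψ_counit, ψπa, ψ_counit]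
  have eq1 : toConv ((Algebra.linearMap k H ∘ₗ counit) ∘ₗ π) = 1 := by
    rw [LinearMap.comp_assoc, π_counit]; rfl
  have inv1 : toConv π * toConv (antipode k ∘ₗ π) = 1 := by
    have h' := conv_comp_coalg π_comul (f := LinearMap.id) (g := antipode k)
      (h := Algebra.linearMap k H ∘ₗ counit) (LinearMap.id_mul_antipode (R := k) (C := H))
    rw [eq1] at h'
    exact h'
  have inv2 : toConv (antipode k ∘ₗ π) * toConv π = 1 := by
    have h' := conv_comp_coalg π_comul (g := LinearMap.id) (f := antipode k)
      (h := Algebra.linearMap k H ∘ₗ counit) (LinearMap.antipode_mul_id (R := k) (C := H))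
    rw [eq1] at h'
    exact h'
  set P : H →ₗ[k] H := (toConv LinearMap.id * toConv (antipode k ∘ₗ π)).ofConv with hP
  let ρ : H →ₐ[k] H ⊗[k] H := (Algebra.TensorProduct.map (AlgHom.id k H) πA).comp (Bialgebra.comulAlgHom k H)
  have hρ : ρ.toLinearMap = TensorProduct.map LinearMap.id π ∘ₗ comul := rfl
  have a1 := conv_comp_algHom (k := k) (Algebra.TensorProduct.includeLeft : H →ₐ[k] H ⊗[k] H) inv2
  have b1 := conv_comp_algHom (k := k) (Algebra.TensorProduct.includeRight : H →ₐ[k] H ⊗[k] H) inv2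
  have b2 := conv_comp_algHom (k := k) (Algebra.TensorProduct.includeRight : H →ₐ[k] H ⊗[k] H) inv1
  have r1 := conv_comp_algHom (k := k) ρ inv1
  have r2 := conv_incl (k := k) (H := H) LinearMap.id π
  have r3 := conv_comp_coalg π_comul r2
  simp only [LinearMap.comp_id, LinearMap.comp_assoc, ππ] at r2 r3
  have r4 : toConv (ρ.toLinearMap ∘ₗ antipode k ∘ₗ π) = toConv (AlgHom.toLinearMap (Algebra.TensorProduct.includeRight : H →ₐ[k] H ⊗[k] H) ∘ₗ antipode k ∘ₗ π) *
      toConv (AlgHom.toLinearMap (Algebra.TensorProduct.includeLeft : H →ₐ[k] H ⊗[k] H) ∘ₗ antipode k ∘ₗ π) := by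
    symm
    refine left_inv_eq_right_inv ?_ r1
    rw [hρ, LinearMap.comp_assoc, ← r3, mul_assoc, ← mul_assoc _ _ (toConv (AlgHom.toLinearMap (Algebra.TensorProduct.includeRight : H →ₐ[k] H ⊗[k] H) ∘ₗ π)), a1,
      one_mul, b1]
  have r5 : ρ.toLinearMap ∘ₗ P = AlgHom.toLinearMap (Algebra.TensorProduct.includeLeft : H →ₐ[k] H ⊗[k] H) ∘ₗ P := by
    rw [hP, LinearMap.algHom_comp_convMul_distrib, LinearMap.algHom_comp_convMul_distrib]
    simp only [ofConv_toConv]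
    congr 1
    rw [r4, LinearMap.comp_id, LinearMap.comp_id, hρ, ← r2]
    rw [mul_assoc, ← mul_assoc (toConv (AlgHom.toLinearMap (Algebra.TensorProduct.includeRight : H →ₐ[k] H ⊗[k] H) ∘ₗ π)), b2, one_mul]
  have r6 : ∀ x, P x = counit (R := k) (P x) • (1 : H) := by
    intro x
    apply coinv_descent n
    have := congrArg (TensorProduct.map LinearMap.id ψ) (LinearMap.congr_fun r5 x)
    simp only [hρ, LinearMap.comp_apply, TensorProduct.map_map] at this
    rw [LinearMap.comp_id, hg'] at this
    rw [← hφ, ← hψ_def, this]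
    simp [ψ_one]
  have r7 : toConv P * toConv π = toConv LinearMap.id := by
    rw [hP, toConv_ofConv, mul_assoc, inv2, mul_one]
  have r8 : ∀ x, ∃ y, π y = x := by
    intro x
    have := congrArg (fun z => z.ofConv x) r7
    simp only [LinearMap.convMul_apply, ofConv_toConv, LinearMap.id_apply] at this
    refine ⟨TensorProduct.lid k H (TensorProduct.map (counit ∘ₗ P) LinearMap.id (comul x)), ?_⟩
    conv_rhs => rw [← this]
    generalize (comul (R := k) x) = z
    induction z with
    | zero => simp
    | add a b ha hb => simp only [map_add, ha, hb]
    | tmul a b =>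
      simp only [TensorProduct.map_tmul, TensorProduct.lid_tmul, LinearMap.comp_apply,
        LinearMap.id_apply, LinearMap.mul'_apply, map_smul]
      conv_rhs => rw [r6 a, smul_mul_assoc, one_mul]
  have hs : Function.Surjective (antipode k (A := H)) := by
    intro x
    obtain ⟨y, hy⟩ := r8 x
    obtain ⟨m, rfl⟩ := Nat.exists_eq_add_of_le' hn
    refine ⟨antipode k ((φ ^ m) (g y)), ?_⟩
    rw [← hy, πa, hψ_def, pow_succ', Module.End.mul_apply]
    rfl
  exact ⟨LinearMap.injective_iff_surjective.2 hs, hs⟩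
end Antipode
end DY

namespace DY
open scoped TensorProduct
open Coalgebra
noncomputable section

section Op
variable {k : Type u} [Field k] {B : Type v} [Ring B] [Bialgebra k B]

theorem op_comul (b : B) : comul (R := k) (MulOpposite.op b) =
    TensorProduct.map (MulOpposite.opLinearEquiv k).toLinearMap
      (MulOpposite.opLinearEquiv k).toLinearMap (comul (R := k) b) := rfl

/-- The bialgebra opposite to `B`: opposite product, same coproduct. -/
instance opBialgebra : Bialgebra k Bᵐᵒᵖ where
  counit_one := by
    change counit (R := k) (1 : B) = 1
    simp
  mul_compr₂_counit := by
    ext x y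
    change counit (R := k) (y.unop * x.unop) = counit (R := k) x.unop * counit (R := k) y.unop
    rw [Bialgebra.counit_mul, mul_comm]
  comul_one := by
    change comul (R := k) (MulOpposite.op (1 : B)) = 1
    rw [op_comul, Bialgebra.comul_one]
    rfl
  mul_compr₂_comul := by
    ext x y
    obtain ⟨x⟩ := x
    obtain ⟨y⟩ := y
    change comul (R := k) (MulOpposite.op (y * x)) =
      comul (R := k) (MulOpposite.op x) * comul (R := k) (MulOpposite.op y)
    rw [op_comul, op_comul, op_comul, Bialgebra.comul_mul]
    generalize comul (R := k) x = p
    generalize comul (R := k) y = q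
    induction p with
    | zero => simp
    | add a b ha hb => simp only [mul_add, map_add, ha, hb, add_mul]
    | tmul a b =>
      induction q with
      | zero => simp
      | add a b ha hb => simp only [add_mul, map_add, ha, hb, mul_add]
      | tmul c d => simp

end Op

section Dual
variable (k : Type u) [Field k] (B : Type v) [Ring B] [Bialgebra k B]

/-- The dual of a bialgebra; its product is the convolution product
`(f * g) b = f b₁ * g b₂`. -/
def Dual : Type (max u v) := WithConv (B →ₗ[k] k)

instance : Ring (Dual k B) := inferInstanceAs (Ring (WithConv (B →ₗ[k] k)))

instance : Algebra k (Dual k B) := inferInstanceAs (Algebra k (WithConv (B →ₗ[k] k)))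

/-- An element of the dual, seen as a linear form. -/
def ev : Dual k B ≃ₗ[k] (B →ₗ[k] k) where
  toFun f := WithConv.ofConv f
  invFun f := WithConv.toConv f
  map_add' _ _ := rfl
  map_smul' _ _ := rfl
  left_inv _ := rfl
  right_inv _ := rfl

variable {k B}

theorem ev_mul (f g : Dual k B) (b : B) :
    ev k B (f * g) b = LinearMap.mul' k k (TensorProduct.map (ev k B f) (ev k B g) (comul b)) := rfl

theorem ev_one (b : B) : ev k B 1 b = counit b := rfl

variable (k B) in
/-- The counit of the dual, evaluation at `1`. -/
def dualCounit : Dual k B →ₗ[k] k := LinearMap.applyₗ (1 : B) ∘ₗ (ev k B).toLinearMap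

theorem dualCounit_apply (f : Dual k B) : dualCounit k B f = ev k B f 1 := rfl

variable [FiniteDimensional k B]

instance : FiniteDimensional k (Dual k B) := Module.Finite.equiv (ev k B).symm

variable {C : Type w} [Ring C] [Bialgebra k C] [FiniteDimensional k C]

variable (k B C) in
/-- The isomorphism from `B^* ⊗ C^*` onto `(B ⊗ C)^*` with `(f ⊗ g)(b ⊗ c) = f b * g c`. -/
def pair : Dual k B ⊗[k] Dual k C ≃ₗ[k] (B ⊗[k] C →ₗ[k] k) :=
  (TensorProduct.congr (ev k B) (ev k C)).trans (TensorProduct.dualDistribEquiv k B C)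

@[simp] theorem pair_tmul (f : Dual k B) (g : Dual k C) (m : B) (n : C) :
    pair k B C (f ⊗ₜ g) (m ⊗ₜ n) = ev k B f m * ev k C g n := by
  simp [pair, TensorProduct.dualDistribEquiv, TensorProduct.dualDistribEquivOfBasis]

/-- The coproduct of the dual, transpose to the product. -/
def dualComul : Dual k B →ₗ[k] Dual k B ⊗[k] Dual k B :=
  (pair k B B).symm.toLinearMap ∘ₗ LinearMap.lcomp k k (LinearMap.mul' k B) ∘ₗ (ev k B).toLinearMap

theorem pair_dualComul (f : Dual k B) (a b : B) :
    pair k B B (dualComul f) (a ⊗ₜ b) = ev k B f (a * b) := by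
  simp [dualComul]

theorem pair_map_mul (p q : Dual k B ⊗[k] Dual k B) (a b : B) :
    pair k B B (p * q) (a ⊗ₜ b) = LinearMap.mul' k k (TensorProduct.map (pair k B B p) (pair k B B q)
      (TensorProduct.tensorTensorTensorComm k B B B B (comul a ⊗ₜ comul b))) := by
  induction p with
  | zero => simp
  | add x y hx hy => simp only [add_mul, map_add, hx, hy, LinearMap.add_apply, TensorProduct.map_add_left]
  | tmul x y =>
  induction q with
  | zero => simp
  | add x y hx hy => simp only [mul_add, map_add, hx, hy, LinearMap.add_apply, TensorProduct.map_add_right]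
  | tmul z w =>
    rw [Algebra.TensorProduct.tmul_mul_tmul, pair_tmul, ev_mul, ev_mul]
    generalize comul (R := k) a = p
    generalize comul (R := k) b = q
    induction p with
    | zero => simp
    | add a b ha hb => simp only [TensorProduct.add_tmul, map_add, add_mul, ha, hb]
    | tmul a b =>
      induction q with
      | zero => simp
      | add a b ha hb => simp only [TensorProduct.tmul_add, map_add, mul_add, ha, hb]
      | tmul c d => simp [mul_mul_mul_comm]

/-- Threefold version of `pair`. -/
def pair3 : Dual k B ⊗[k] (Dual k B ⊗[k] Dual k B) ≃ₗ[k] (B ⊗[k] (B ⊗[k] B) →ₗ[k] k) :=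
  (TensorProduct.congr (LinearEquiv.refl k _)
    ((pair k B B).trans (ev k (B ⊗[k] B)).symm)).trans (pair k B (B ⊗[k] B))

theorem pair3_tmul (f : Dual k B) (z : Dual k B ⊗[k] Dual k B) (a b c : B) :
    pair3 (f ⊗ₜ z) (a ⊗ₜ (b ⊗ₜ c)) = ev k B f a * pair k B B z (b ⊗ₜ c) := by
  simp [pair3]

theorem pair3_assoc (f : Dual k B) (z : Dual k B ⊗[k] Dual k B) (a b c : B) :
    pair3 (TensorProduct.assoc k _ _ _ (z ⊗ₜ f)) (a ⊗ₜ (b ⊗ₜ c)) = pair k B B z (a ⊗ₜ b) * ev k B f c := by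
  induction z with
  | zero => simp
  | add x y hx hy => simp only [TensorProduct.add_tmul, map_add, LinearMap.add_apply, hx, hy, add_mul]
  | tmul x y => simp [pair3_tmul, mul_assoc]

/-- The coalgebra structure on the dual of a finite-dimensional bialgebra. -/
instance dualCoalgebra : Coalgebra k (Dual k B) where
  comul := dualComul
  counit := dualCounit k B
  coassoc := by
    ext f : 1
    apply pair3.injective
    refine TensorProduct.ext' fun a z => ?_
    induction z with
    | zero => simp
    | add x y hx hy => simp only [TensorProduct.tmul_add, map_add, hx, hy]
    | tmul b c =>
      have h1 : ∀ z : Dual k B ⊗[k] Dual k B, pair3 (TensorProduct.assoc k _ _ _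
          (LinearMap.rTensor _ dualComul z)) (a ⊗ₜ (b ⊗ₜ c)) = pair k B B z ((a * b) ⊗ₜ c) := by
        intro z
        induction z with
        | zero => simp
        | add x y hx hy => simp only [map_add, LinearMap.add_apply, hx, hy]
        | tmul x y => simp [pair3_assoc, pair_dualComul]
      have h2 : ∀ z : Dual k B ⊗[k] Dual k B, pair3
          (LinearMap.lTensor _ dualComul z) (a ⊗ₜ (b ⊗ₜ c)) = pair k B B z (a ⊗ₜ (b * c)) := by
        intro z
        induction z with
        | zero => simp
        | add x y hx hy => simp only [map_add, LinearMap.add_apply, hx, hy]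
        | tmul x y => simp [pair3_tmul, pair_dualComul]
      simp only [LinearMap.comp_apply, LinearEquiv.coe_coe]
      rw [h1, h2, pair_dualComul, pair_dualComul, mul_assoc]
  rTensor_counit_comp_comul := by
    ext f : 1
    apply (TensorProduct.lid k _).injective
    have h : ∀ (z : Dual k B ⊗[k] Dual k B) (a : B),
      ev k B (TensorProduct.lid k _ (LinearMap.rTensor _ (dualCounit k B) z)) a = pair k B B z (1 ⊗ₜ a) := by
      intro z a
      induction z with
      | zero => simp
      | add x y hx hy => simp only [map_add, LinearMap.add_apply, hx, hy]
      | tmul x y => simp [dualCounit_apply]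
    apply (ev k B).injective
    ext a
    simp only [LinearMap.comp_apply]
    rw [h, pair_dualComul]
    simp
  lTensor_counit_comp_comul := by
    ext f : 1
    apply (TensorProduct.rid k _).injective
    have h : ∀ (z : Dual k B ⊗[k] Dual k B) (a : B),
      ev k B (TensorProduct.rid k _ (LinearMap.lTensor _ (dualCounit k B) z)) a = pair k B B z (a ⊗ₜ 1) := by
      intro z a
      induction z with
      | zero => simp
      | add x y hx hy => simp only [map_add, LinearMap.add_apply, hx, hy]
      | tmul x y => simp [dualCounit_apply, mul_comm]
    apply (ev k B).injective
    ext a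
    simp only [LinearMap.comp_apply]
    rw [h, pair_dualComul]
    simp

/-- The dual bialgebra of a finite-dimensional bialgebra. -/
instance dualBialgebra : Bialgebra k (Dual k B) where
  counit_one := by
    change ev k B 1 1 = 1
    rw [ev_one]
    simp
  mul_compr₂_counit := by
    ext f g
    change ev k B (f * g) 1 = ev k B f 1 * ev k B g 1
    rw [ev_mul, Bialgebra.comul_one, Algebra.TensorProduct.one_def]
    simp
  comul_one := by
    apply (pair k B B).injective
    ext a b
    change pair k B B (dualComul 1) (a ⊗ₜ b) = pair k B B (1 ⊗ₜ 1) (a ⊗ₜ b)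
    rw [pair_dualComul]
    simp [ev_one]
  mul_compr₂_comul := by
    ext f g
    apply (pair k B B).injective
    ext a b
    change pair k B B (dualComul (f * g)) (a ⊗ₜ b) = pair k B B (dualComul f * dualComul g) (a ⊗ₜ b)
    rw [pair_dualComul, pair_map_mul, ev_mul, Bialgebra.comul_mul]
    generalize comul (R := k) a = p
    generalize comul (R := k) b = q
    induction p with
    | zero => simp
    | add a b ha hb => simp only [TensorProduct.add_tmul, map_add, add_mul, ha, hb]
    | tmul a b =>
      induction q with
      | zero => simp
      | add a b ha hb => simp only [TensorProduct.tmul_add, map_add, mul_add, ha, hb]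
      | tmul c d => simp [pair_dualComul]

end Dual
end
end DY

namespace DY
open scoped TensorProduct
open Coalgebra
noncomputable section

section Ad
variable {k : Type u} [Field k] {R : Type v} [Ring R] [Algebra k R]

/-- Conjugation `x ↦ u x u⁻¹` by an invertible element. -/
def Ad (u : Rˣ) : R →ₐ[k] R where
  toFun x := u * x * (u⁻¹ : Rˣ)
  map_one' := by simp
  map_mul' x y := by simp [mul_assoc]
  map_zero' := by simp
  map_add' x y := by simp [mul_add, add_mul]
  commutes' c := by rw [← Algebra.commutes, mul_assoc]; simp

theorem Ad_apply (u : Rˣ) (x : R) : Ad (k := k) u x = u * x * (u⁻¹ : Rˣ) := rfl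

end Ad

section con
variable {k : Type u} [Field k] {H : Type v} [Ring H] [Bialgebra k H] [FiniteDimensional k H]
  {A : Type w} [Ring A] [Algebra k A]

variable (k H A) in
/-- The isomorphism from `A ⊗ H^*` onto the linear maps `H → A`. -/
def con : A ⊗[k] Dual k H ≃ₗ[k] (H →ₗ[k] A) :=
  (TensorProduct.comm k A (Dual k H)).trans
    ((TensorProduct.congr (ev k H) (LinearEquiv.refl k A)).trans (dualTensorHomEquiv k H A))

@[simp] theorem con_tmul (a : A) (f : Dual k H) (h : H) :
    con k H A (a ⊗ₜ f) h = ev k H f h • a := by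
  simp [con, dualTensorHomEquiv]

theorem con_mul (z w : A ⊗[k] Dual k H) (h : H) : con k H A (z * w) h =
    LinearMap.mul' k A (TensorProduct.map (con k H A z) (con k H A w) (comul h)) := by
  induction z with
  | zero => simp
  | add x y hx hy => simp only [add_mul, map_add, LinearMap.add_apply, hx, hy, TensorProduct.map_add_left]
  | tmul a f =>
    induction w with
    | zero => simp
    | add x y hx hy => simp only [mul_add, map_add, LinearMap.add_apply, hx, hy, TensorProduct.map_add_right]
    | tmul b g =>
      rw [Algebra.TensorProduct.tmul_mul_tmul, con_tmul, ev_mul]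
      generalize comul (R := k) h = p
      induction p with
      | zero => simp
      | add x y hx hy => simp only [map_add, add_smul, hx, hy]
      | tmul x y => simp [smul_smul, mul_comm]

theorem con_map {A' : Type*} [Ring A'] [Algebra k A'] (g : A →ₗ[k] A') (z : A ⊗[k] Dual k H) :
    con k H A' (TensorProduct.map g LinearMap.id z) = g ∘ₗ con k H A z := by
  induction z with
  | zero => simp
  | add x y hx hy => simp only [map_add, hx, hy, LinearMap.comp_add]
  | tmul a f => ext h; simp

variable (k H) in
/-- The canonical element `∑ hᵢ ⊗ ĥᵢ` of `H ⊗ H^*`. -/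
def canon : H ⊗[k] Dual k H :=
  TensorProduct.map LinearMap.id (ev k H).symm.toLinearMap (coevaluation k H 1)

theorem con_canon : con k H H (canon k H) = LinearMap.id := by
  ext h
  conv_rhs => rw [LinearMap.id_apply, ← (Module.Basis.ofVectorSpace k H).sum_repr h]
  simp only [canon, coevaluation_apply_one, map_sum, LinearMap.sum_apply, TensorProduct.map_tmul,
    LinearMap.id_apply, con_tmul, LinearEquiv.coe_coe, LinearEquiv.apply_symm_apply, Module.Basis.coord_apply]

theorem con_map_canon (f : H →ₗ[k] A) :
    con k H A (TensorProduct.map f LinearMap.id (canon k H)) = f := by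
  rw [con_map, con_canon, LinearMap.comp_id]

/-- Twofold version of `con`. -/
def con2 : A ⊗[k] (Dual k H ⊗[k] Dual k H) ≃ₗ[k] (H ⊗[k] H →ₗ[k] A) :=
  (TensorProduct.congr (LinearEquiv.refl k A)
    ((pair k H H).trans (ev k (H ⊗[k] H)).symm)).trans (con k (H ⊗[k] H) A)

theorem con2_tmul (a : A) (z : Dual k H ⊗[k] Dual k H) (t : H ⊗[k] H) :
    con2 (a ⊗ₜ z) t = pair k H H z t • a := by
  simp [con2]

theorem con2_comul (z : A ⊗[k] Dual k H) (g h : H) :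
    con2 (Algebra.TensorProduct.map (AlgHom.id k A) (Bialgebra.comulAlgHom k (Dual k H)) z)
      (g ⊗ₜ h) = con k H A z (g * h) := by
  induction z with
  | zero => simp
  | add x y hx hy => simp only [map_add, hx, hy, LinearMap.add_apply]
  | tmul a f =>
    rw [con_tmul, ← pair_dualComul, ← con2_tmul]
    rfl

theorem con2_mul (z w : A ⊗[k] Dual k H) (g h : H) :
    con2 (Algebra.TensorProduct.map (AlgHom.id k A) Algebra.TensorProduct.includeRight z *
      Algebra.TensorProduct.map (AlgHom.id k A) Algebra.TensorProduct.includeLeft w) (g ⊗ₜ h) =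
    con k H A z h * con k H A w g := by
  induction z with
  | zero => simp
  | add x y hx hy => simp only [add_mul, map_add, LinearMap.add_apply, hx, hy]
  | tmul a f =>
    induction w with
    | zero => simp
    | add x y hx hy => simp only [mul_add, map_add, LinearMap.add_apply, hx, hy]
    | tmul b g => simp [con2_tmul, smul_smul, mul_comm]

end con

section opU
variable (k : Type u) [Field k] (H : Type v) [Ring H] [HopfAlgebra k H] [FiniteDimensional k H]

/-- The inverse of the antipode of a finite-dimensional Hopf algebra. -/
def antipodeInv : H →ₗ[k] H :=
  (LinearEquiv.ofBijective (HopfAlgebra.antipode k (A := H)) antipode_bijective).symm.toLinearMap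

variable {k H} in
theorem antipode_antipodeInv (h : H) :
    HopfAlgebra.antipode k (antipodeInv k H h) = h :=
  (LinearEquiv.ofBijective (HopfAlgebra.antipode k (A := H)) antipode_bijective).apply_symm_apply h

variable {k H} in
theorem antipodeInv_antipode (h : H) :
    antipodeInv k H (HopfAlgebra.antipode k h) = h :=
  (LinearEquiv.ofBijective (HopfAlgebra.antipode k (A := H)) antipode_bijective).symm_apply_apply h

/-- The map `h ↦ op h`. -/
abbrev opL : H →ₗ[k] Hᵐᵒᵖ := (MulOpposite.opLinearEquiv k).toLinearMap

/-- The invertible element `∑ op hᵢ ⊗ ĥᵢ` of `H^op ⊗ H^*`; its inverse is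
`∑ op (S⁻¹ hᵢ) ⊗ ĥᵢ`. -/
def opU : (Hᵐᵒᵖ ⊗[k] Dual k H)ˣ where
  val := TensorProduct.map (opL k H) LinearMap.id (canon k H)
  inv := TensorProduct.map (opL k H ∘ₗ antipodeInv k H) LinearMap.id (canon k H)
  val_inv := by
    apply (con k H Hᵐᵒᵖ).injective
    ext h
    rw [con_mul, con_map_canon, con_map_canon, Algebra.TensorProduct.one_def, con_tmul, ev_one]
    apply MulOpposite.unop_injective
    apply (antipode_bijective (k := k) (H := H)).1
    have e := HopfAlgebra.mul_antipode_rTensor_comul_apply (R := k) h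
    have e2 : ∀ z : H ⊗[k] H, HopfAlgebra.antipode k (MulOpposite.unop (LinearMap.mul' k Hᵐᵒᵖ
        (TensorProduct.map (opL k H) (opL k H ∘ₗ antipodeInv k H) z))) =
        LinearMap.mul' k H ((HopfAlgebra.antipode k).rTensor H z) := by
      intro z
      induction z with
      | zero => simp
      | add x y hx hy => simp only [map_add, MulOpposite.unop_add, hx, hy]
      | tmul x y => simp [HopfAlgebra.antipode_mul_antidistrib, antipode_antipodeInv]
    rw [e2, e]
    simp [Algebra.algebraMap_eq_smul_one]
  inv_val := by
    apply (con k H Hᵐᵒᵖ).injective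
    ext h
    rw [con_mul, con_map_canon, con_map_canon, Algebra.TensorProduct.one_def, con_tmul, ev_one]
    apply MulOpposite.unop_injective
    apply (antipode_bijective (k := k) (H := H)).1
    have e := HopfAlgebra.mul_antipode_lTensor_comul_apply (R := k) h
    have e2 : ∀ z : H ⊗[k] H, HopfAlgebra.antipode k (MulOpposite.unop (LinearMap.mul' k Hᵐᵒᵖ
        (TensorProduct.map (opL k H ∘ₗ antipodeInv k H) (opL k H) z))) =
        LinearMap.mul' k H ((HopfAlgebra.antipode k).lTensor H z) := by
      intro z
      induction z with
      | zero => simp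
      | add x y hx hy => simp only [map_add, MulOpposite.unop_add, hx, hy]
      | tmul x y => simp [HopfAlgebra.antipode_mul_antidistrib, antipode_antipodeInv]
    rw [e2, e]
    simp [Algebra.algebraMap_eq_smul_one]

variable {k H}
theorem con_opU : con k H Hᵐᵒᵖ (opU k H).val = opL k H := con_map_canon (opL k H)

theorem opU_comul_left :
    Algebra.TensorProduct.map (Bialgebra.comulAlgHom k Hᵐᵒᵖ) (AlgHom.id k (Dual k H)) (opU k H).val =
    Algebra.TensorProduct.map
      (Algebra.TensorProduct.includeLeft : Hᵐᵒᵖ →ₐ[k] Hᵐᵒᵖ ⊗[k] Hᵐᵒᵖ) (AlgHom.id k _) (opU k H).val *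
    Algebra.TensorProduct.map
      (Algebra.TensorProduct.includeRight : Hᵐᵒᵖ →ₐ[k] Hᵐᵒᵖ ⊗[k] Hᵐᵒᵖ) (AlgHom.id k _) (opU k H).val := by
  apply (con k H (Hᵐᵒᵖ ⊗[k] Hᵐᵒᵖ)).injective
  ext h
  rw [con_mul]
  have e : ∀ (f : Hᵐᵒᵖ →ₐ[k] Hᵐᵒᵖ ⊗[k] Hᵐᵒᵖ), con k H _
      (Algebra.TensorProduct.map f (AlgHom.id k (Dual k H)) (opU k H).val) =
      f.toLinearMap ∘ₗ opL k H := by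
    intro f
    rw [← con_opU]
    exact con_map f.toLinearMap _
  rw [e, e, e]
  change comul (R := k) (MulOpposite.op h) = _
  rw [op_comul]
  generalize comul (R := k) h = z
  induction z with
  | zero => simp
  | add x y hx hy => simp only [map_add, hx, hy]
  | tmul x y => simp

theorem opU_comul_right :
    Algebra.TensorProduct.map (AlgHom.id k Hᵐᵒᵖ) (Bialgebra.comulAlgHom k (Dual k H)) (opU k H).val =
    Algebra.TensorProduct.map (AlgHom.id k _) Algebra.TensorProduct.includeRight (opU k H).val *
    Algebra.TensorProduct.map (AlgHom.id k _) Algebra.TensorProduct.includeLeft (opU k H).val := by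
  apply con2.injective
  ext g h
  simp only [TensorProduct.AlgebraTensorModule.curry_apply, TensorProduct.curry_apply,
    LinearMap.coe_restrictScalars]
  rw [con2_comul, con2_mul, con_opU]
  simp

theorem opU_counit_left :
    Algebra.TensorProduct.map (Bialgebra.counitAlgHom k Hᵐᵒᵖ) (AlgHom.id k (Dual k H)) (opU k H).val
      = 1 := by
  apply (con k H k).injective
  have e := con_map (Bialgebra.counitAlgHom k Hᵐᵒᵖ).toLinearMap (opU k H).val
  rw [con_opU] at e
  refine e.trans ?_
  ext h
  rw [Algebra.TensorProduct.one_def, con_tmul, ev_one]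
  change counit (R := k) h = _
  simp

theorem opU_counit_right :
    Algebra.TensorProduct.map (AlgHom.id k Hᵐᵒᵖ) (Bialgebra.counitAlgHom k (Dual k H)) (opU k H).val
      = 1 := by
  have e : ∀ z : Hᵐᵒᵖ ⊗[k] Dual k H,
      Algebra.TensorProduct.map (AlgHom.id k Hᵐᵒᵖ) (Bialgebra.counitAlgHom k (Dual k H)) z =
      con k H Hᵐᵒᵖ z 1 ⊗ₜ 1 := by
    intro z
    induction z with
    | zero => simp
    | add x y hx hy => simp only [map_add, hx, hy, LinearMap.add_apply, TensorProduct.add_tmul]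
    | tmul a f =>
      rw [con_tmul, TensorProduct.smul_tmul]
      change a ⊗ₜ (ev k H f 1) = _
      simp
  rw [e, con_opU]
  simp [Algebra.TensorProduct.one_def]

end opU
end
end DY

namespace DY
open scoped TensorProduct
open Coalgebra
noncomputable section

section twist
variable {k : Type u} [Field k]

/-- The image of an invertible element under an algebra homomorphism. -/
def mapUnit {R : Type v} {S : Type w} [Ring R] [Algebra k R] [Ring S] [Algebra k S]
    (f : R →ₐ[k] S) (u : Rˣ) : Sˣ := Units.map (f : R →* S) u

@[simp] theorem val_mapUnit {R : Type v} {S : Type w} [Ring R] [Algebra k R] [Ring S] [Algebra k S]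
    (f : R →ₐ[k] S) (u : Rˣ) : (mapUnit f u).val = f u.val := rfl

@[simp] theorem val_inv_mapUnit {R : Type v} {S : Type w} [Ring R] [Algebra k R] [Ring S]
    [Algebra k S] (f : R →ₐ[k] S) (u : Rˣ) : ((mapUnit f u)⁻¹).val = f (u⁻¹).val := rfl

theorem comp_Ad {R : Type*} {S : Type*} [Ring R] [Algebra k R] [Ring S] [Algebra k S]
    (f : R →ₐ[k] S) (u : Rˣ) : f.comp (Ad u) = (Ad (mapUnit f u)).comp f := by
  ext x
  simp only [AlgHom.comp_apply, Ad_apply, map_mul]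
  rfl

theorem Ad_comp_Ad {R : Type*} [Ring R] [Algebra k R] (u v : Rˣ) :
    (Ad (k := k) u).comp (Ad v) = Ad (u * v) := by
  ext x
  simp [AlgHom.comp_apply, Ad_apply, mul_assoc]

theorem twist_coassoc {K : Type v} [Ring K] [Bialgebra k K] (F : (K ⊗[k] K)ˣ)
    (e : Algebra.TensorProduct.assoc k k k K K K ((F.val ⊗ₜ 1) *
      Algebra.TensorProduct.map (Bialgebra.comulAlgHom k K) (AlgHom.id k K) F.val) =
      (1 ⊗ₜ F.val) * Algebra.TensorProduct.map (AlgHom.id k K) (Bialgebra.comulAlgHom k K) F.val)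
    {D : K →ₐ[k] K ⊗[k] K} (hD : D = (Ad F).comp (Bialgebra.comulAlgHom k K)) :
    (Algebra.TensorProduct.assoc k k k K K K).toAlgHom.comp
      ((Algebra.TensorProduct.map D (.id k K)).comp D) =
    (Algebra.TensorProduct.map (.id k K) D).comp D := by
  let Δ := Bialgebra.comulAlgHom k K
  let L : K ⊗[k] K →ₐ[k] K ⊗[k] (K ⊗[k] K) := (Algebra.TensorProduct.assoc k k k K K K).toAlgHom.comp
    (Algebra.TensorProduct.map Δ (.id k K))
  let R : K ⊗[k] K →ₐ[k] K ⊗[k] (K ⊗[k] K) := Algebra.TensorProduct.map (.id k K) Δ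
  have co : L.comp Δ = R.comp Δ := by
    ext x
    exact Coalgebra.coassoc_apply (R := k) x
  let a : K ⊗[k] K →ₐ[k] K ⊗[k] (K ⊗[k] K) := (Algebra.TensorProduct.assoc k k k K K K).toAlgHom.comp
    Algebra.TensorProduct.includeLeft
  let b : K ⊗[k] K →ₐ[k] K ⊗[k] (K ⊗[k] K) := Algebra.TensorProduct.includeRight
  have a_comm : ∀ (z : K ⊗[k] K) (x : K), a z * 1 ⊗ₜ (1 ⊗ₜ x) = 1 ⊗ₜ (1 ⊗ₜ x) * a z := by
    intro z x
    have e1 : (1 ⊗ₜ (1 ⊗ₜ x) : K ⊗[k] (K ⊗[k] K)) =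
      Algebra.TensorProduct.assoc k k k K K K ((1 : K ⊗[k] K) ⊗ₜ x) := by
      simp [Algebra.TensorProduct.one_def]
    rw [e1]
    change Algebra.TensorProduct.assoc k k k K K K (z ⊗ₜ 1) * _ =
      _ * Algebra.TensorProduct.assoc k k k K K K (z ⊗ₜ 1)
    rw [← map_mul, ← map_mul, Algebra.TensorProduct.tmul_mul_tmul,
      Algebra.TensorProduct.tmul_mul_tmul, one_mul, one_mul, mul_one, mul_one]
  have h1 : (Algebra.TensorProduct.assoc k k k K K K).toAlgHom.comp
      (Algebra.TensorProduct.map D (.id k K)) = (Ad (mapUnit a F)).comp L := by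
    rw [hD]
    apply Algebra.TensorProduct.ext
    · ext x
      have := DFunLike.congr_fun (comp_Ad a F) (Δ x)
      simpa [a, L, Δ, Algebra.TensorProduct.one_def] using this
    · ext x
      have e3 : L (1 ⊗ₜ x) = 1 ⊗ₜ (1 ⊗ₜ x) := by simp [L, Algebra.TensorProduct.one_def]
      have e4 : a F.val * 1 ⊗ₜ (1 ⊗ₜ x) = 1 ⊗ₜ (1 ⊗ₜ x) * a F.val := a_comm F.val x
      have e5 : a F.val * a (F⁻¹).val = 1 := by rw [← map_mul]; simp
      simp only [AlgHom.comp_apply, Algebra.TensorProduct.includeRight_apply,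
        AlgHom.coe_restrictScalars', Ad_apply, val_mapUnit, val_inv_mapUnit]
      rw [e3, e4, mul_assoc, e5, mul_one]
      have e6 : Ad (k := k) F ((1 : K) ⊗ₜ (1 : K)) = (1 : K) ⊗ₜ (1 : K) := map_one (Ad (k := k) F)
      simp [Algebra.TensorProduct.one_def, e6]
  have h2 : Algebra.TensorProduct.map (.id k K) D = (Ad (mapUnit b F)).comp R := by
    rw [hD]
    apply Algebra.TensorProduct.ext
    · ext x
      simp [R, b, Ad_apply]
    · ext x
      have := DFunLike.congr_fun (comp_Ad b F) (Δ x)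
      simpa [b, R, Δ, Algebra.TensorProduct.one_def] using this
  have h3 : ∀ (u : (K ⊗[k] (K ⊗[k] K))ˣ) (G : K ⊗[k] K →ₐ[k] K ⊗[k] (K ⊗[k] K)),
      ((Ad u).comp G).comp D = (Ad (u * mapUnit G F)).comp (G.comp Δ) := by
    intro u G
    ext x
    have := DFunLike.congr_fun (comp_Ad G F) (Δ x)
    rw [hD, ← Ad_comp_Ad]
    simp only [AlgHom.comp_apply] at this ⊢
    rw [← this]
  rw [← AlgHom.comp_assoc, h1, h2, h3, h3, co]
  congr 2
  apply Units.ext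
  simpa [a, b, L, R, Δ] using e

theorem twist_counit_left {K : Type v} [Ring K] [Bialgebra k K] (F : (K ⊗[k] K)ˣ)
    (e : Algebra.TensorProduct.map (Bialgebra.counitAlgHom k K) (AlgHom.id k K) F.val = 1)
    {D : K →ₐ[k] K ⊗[k] K} (hD : D = (Ad F).comp (Bialgebra.comulAlgHom k K)) :
    (Algebra.TensorProduct.map (Bialgebra.counitAlgHom k K) (.id k K)).comp D =
      (Algebra.TensorProduct.lid k K).symm := by
  rw [hD, ← AlgHom.comp_assoc, comp_Ad]
  have : mapUnit (Algebra.TensorProduct.map (Bialgebra.counitAlgHom k K) (AlgHom.id k K) :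
    K ⊗[k] K →ₐ[k] k ⊗[k] K) F = 1 := Units.ext e
  rw [this]
  ext x
  simp only [AlgHom.comp_apply, Ad_apply]
  simp only [inv_one, Units.val_one, one_mul, mul_one]
  exact Coalgebra.rTensor_counit_comul (R := k) x

theorem twist_counit_right {K : Type v} [Ring K] [Bialgebra k K] (F : (K ⊗[k] K)ˣ)
    (e : Algebra.TensorProduct.map (AlgHom.id k K) (Bialgebra.counitAlgHom k K) F.val = 1)
    {D : K →ₐ[k] K ⊗[k] K} (hD : D = (Ad F).comp (Bialgebra.comulAlgHom k K)) :
    (Algebra.TensorProduct.map (.id k K) (Bialgebra.counitAlgHom k K)).comp D =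
      (Algebra.TensorProduct.rid k k K).symm := by
  rw [hD, ← AlgHom.comp_assoc, comp_Ad]
  have : mapUnit (Algebra.TensorProduct.map (AlgHom.id k K) (Bialgebra.counitAlgHom k K) :
    K ⊗[k] K →ₐ[k] K ⊗[k] k) F = 1 := Units.ext e
  rw [this]
  ext x
  simp only [AlgHom.comp_apply, Ad_apply]
  simp only [inv_one, Units.val_one, one_mul, mul_one]
  exact Coalgebra.lTensor_counit_comul (R := k) x

section AB
variable {A : Type v} {B : Type w} [Ring A] [Bialgebra k A] [Ring B] [Bialgebra k B]

variable (k A B) in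
/-- The embedding of `A ⊗ B` as the two middle factors of `A ⊗ A ⊗ B ⊗ B`. -/
def mid : A ⊗[k] B →ₐ[k] (A ⊗[k] A) ⊗[k] (B ⊗[k] B) :=
  Algebra.TensorProduct.map Algebra.TensorProduct.includeRight Algebra.TensorProduct.includeLeft

/-- The map `(id ⊗ Σ Ad(u) ⊗ id) (Δ ⊗ Δ)` on `A ⊗ B`. -/
def twistComul (u : (A ⊗[k] B)ˣ) : A ⊗[k] B →ₐ[k] (A ⊗[k] B) ⊗[k] (A ⊗[k] B) :=
  (Algebra.TensorProduct.tensorTensorTensorComm k k k k A A B B).toAlgHom.comp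
    ((Ad (mapUnit (mid k A B) u)).comp
      (Algebra.TensorProduct.map (Bialgebra.comulAlgHom k A) (Bialgebra.comulAlgHom k B)))

/-- The map `a ⊗ b ↦ (1 ⊗ b) ⊗ (a ⊗ 1)`. -/
def phi : A ⊗[k] B →ₐ[k] (A ⊗[k] B) ⊗[k] (A ⊗[k] B) :=
  (Algebra.TensorProduct.tensorTensorTensorComm k k k k A A B B).toAlgHom.comp (mid k A B)

theorem phi_tmul (a : A) (b : B) : phi (a ⊗ₜ[k] b) = (1 ⊗ₜ b) ⊗ₜ (a ⊗ₜ 1) := by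
  simp [phi, mid]

theorem twistComul_eq (u : (A ⊗[k] B)ˣ) : twistComul u =
    (Ad (mapUnit phi u)).comp (Bialgebra.comulAlgHom k (A ⊗[k] B)) := by
  rw [twistComul, ← AlgHom.comp_assoc, comp_Ad]
  rfl

variable (k A B) in
/-- The map `a ⊗ (b ⊗ c) ↦ (1 ⊗ b) ⊗ ((1 ⊗ c) ⊗ (a ⊗ 1))`. -/
def psi₁ : A ⊗[k] (B ⊗[k] B) →ₐ[k] (A ⊗[k] B) ⊗[k] ((A ⊗[k] B) ⊗[k] (A ⊗[k] B)) :=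
  (Algebra.TensorProduct.assoc k k k _ _ _).toAlgHom.comp
  ((Algebra.TensorProduct.map (Algebra.TensorProduct.map Algebra.TensorProduct.includeRight
      Algebra.TensorProduct.includeRight) Algebra.TensorProduct.includeLeft).comp
    (Algebra.TensorProduct.comm k A (B ⊗[k] B)).toAlgHom)

theorem psi₁_tmul (a : A) (b c : B) : psi₁ k A B (a ⊗ₜ (b ⊗ₜ c)) =
    (1 ⊗ₜ b) ⊗ₜ ((1 ⊗ₜ c) ⊗ₜ (a ⊗ₜ 1)) := by
  simp [psi₁]

variable (k A B) in
/-- The map `(a ⊗ c) ⊗ b ↦ (1 ⊗ b) ⊗ ((a ⊗ 1) ⊗ (c ⊗ 1))`. -/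
def psi₂ : (A ⊗[k] A) ⊗[k] B →ₐ[k] (A ⊗[k] B) ⊗[k] ((A ⊗[k] B) ⊗[k] (A ⊗[k] B)) :=
  (Algebra.TensorProduct.map Algebra.TensorProduct.includeRight
    (Algebra.TensorProduct.map Algebra.TensorProduct.includeLeft
      Algebra.TensorProduct.includeLeft)).comp
    (Algebra.TensorProduct.comm k (A ⊗[k] A) B).toAlgHom

theorem psi₂_tmul (a c : A) (b : B) : psi₂ k A B ((a ⊗ₜ c) ⊗ₜ b) =
    (1 ⊗ₜ b) ⊗ₜ ((a ⊗ₜ 1) ⊗ₜ (c ⊗ₜ 1)) := by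
  simp [psi₂]

theorem comul_right (b : B) : comul (R := k) ((1 : A) ⊗ₜ[k] b) =
    Algebra.TensorProduct.map (Algebra.TensorProduct.includeRight : B →ₐ[k] A ⊗[k] B)
      (Algebra.TensorProduct.includeRight : B →ₐ[k] A ⊗[k] B) (comul (R := k) b) := by
  rw [TensorProduct.comul_tmul, Bialgebra.comul_one, Algebra.TensorProduct.one_def]
  generalize comul (R := k) b = z
  induction z with
  | zero => simp
  | add x y hx hy => simp only [TensorProduct.tmul_add, map_add, hx, hy]
  | tmul x y => simp

theorem comul_left (a : A) : comul (R := k) (a ⊗ₜ[k] (1 : B)) =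
    Algebra.TensorProduct.map (Algebra.TensorProduct.includeLeft : A →ₐ[k] A ⊗[k] B)
      (Algebra.TensorProduct.includeLeft : A →ₐ[k] A ⊗[k] B) (comul (R := k) a) := by
  rw [TensorProduct.comul_tmul, Bialgebra.comul_one, Algebra.TensorProduct.one_def]
  generalize comul (R := k) a = z
  induction z with
  | zero => simp
  | add x y hx hy => simp only [TensorProduct.add_tmul, map_add, hx, hy]
  | tmul x y => simp

theorem phi_comul_left (z : A ⊗[k] B) : Algebra.TensorProduct.assoc k k k _ _ _
    (Algebra.TensorProduct.map (Bialgebra.comulAlgHom k (A ⊗[k] B)) (AlgHom.id k _) (phi z)) =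
    psi₁ k A B (Algebra.TensorProduct.map (AlgHom.id k A) (Bialgebra.comulAlgHom k B) z) := by
  induction z with
  | zero => simp
  | add x y hx hy => simp only [map_add, hx, hy]
  | tmul a b =>
    rw [phi_tmul, Algebra.TensorProduct.map_tmul, Algebra.TensorProduct.map_tmul,
      Bialgebra.comulAlgHom_apply, Bialgebra.comulAlgHom_apply, comul_right]
    rfl

theorem phi_comul_right (z : A ⊗[k] B) :
    Algebra.TensorProduct.map (AlgHom.id k _) (Bialgebra.comulAlgHom k (A ⊗[k] B)) (phi z) =
    psi₂ k A B (Algebra.TensorProduct.map (Bialgebra.comulAlgHom k A) (AlgHom.id k B) z) := by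
  induction z with
  | zero => simp
  | add x y hx hy => simp only [map_add, hx, hy]
  | tmul a b =>
    rw [phi_tmul, Algebra.TensorProduct.map_tmul, Algebra.TensorProduct.map_tmul,
      Bialgebra.comulAlgHom_apply, Bialgebra.comulAlgHom_apply, comul_left]
    rfl

/-- The conditions on an invertible element of `A ⊗ B` under which it twists `A ⊗ B`. -/
structure IsTwist (u : (A ⊗[k] B)ˣ) : Prop where
  comul_left : Algebra.TensorProduct.map (Bialgebra.comulAlgHom k A) (AlgHom.id k B) u.val =
    Algebra.TensorProduct.map
      (Algebra.TensorProduct.includeLeft : A →ₐ[k] A ⊗[k] A) (AlgHom.id k B) u.val *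
    Algebra.TensorProduct.map
      (Algebra.TensorProduct.includeRight : A →ₐ[k] A ⊗[k] A) (AlgHom.id k B) u.val
  comul_right : Algebra.TensorProduct.map (AlgHom.id k A) (Bialgebra.comulAlgHom k B) u.val =
    Algebra.TensorProduct.map (AlgHom.id k A)
      (Algebra.TensorProduct.includeRight : B →ₐ[k] B ⊗[k] B) u.val *
    Algebra.TensorProduct.map (AlgHom.id k A)
      (Algebra.TensorProduct.includeLeft : B →ₐ[k] B ⊗[k] B) u.val
  counit_left : Algebra.TensorProduct.map (Bialgebra.counitAlgHom k A) (AlgHom.id k B) u.val = 1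
  counit_right : Algebra.TensorProduct.map (AlgHom.id k A) (Bialgebra.counitAlgHom k B) u.val = 1

theorem commute_of_tmul {R : Type*} [Ring R] [Algebra k R] (f g : A ⊗[k] B →ₐ[k] R)
    (h : ∀ a b c d, f (a ⊗ₜ b) * g (c ⊗ₜ d) = g (c ⊗ₜ d) * f (a ⊗ₜ b)) (z w : A ⊗[k] B) :
    f z * g w = g w * f z := by
  induction z with
  | zero => simp
  | add x y hx hy => simp only [map_add, add_mul, mul_add, hx, hy]
  | tmul a b =>
    induction w with
    | zero => simp
    | add x y hx hy => simp only [map_add, add_mul, mul_add, hx, hy]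
    | tmul c d => exact h a b c d

theorem phi_commute (z w : A ⊗[k] B) :
    Algebra.TensorProduct.assoc k k k _ _ _ (phi z ⊗ₜ (1 : A ⊗[k] B)) * ((1 : A ⊗[k] B) ⊗ₜ phi w) =
    ((1 : A ⊗[k] B) ⊗ₜ phi w) * Algebra.TensorProduct.assoc k k k _ _ _ (phi z ⊗ₜ (1 : A ⊗[k] B)) :=
  commute_of_tmul ((Algebra.TensorProduct.assoc k k k _ _ _).toAlgHom.comp
    (Algebra.TensorProduct.includeLeft.comp phi)) (Algebra.TensorProduct.includeRight.comp phi)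
    (fun a b c d => by simp [phi_tmul]) z w

theorem psi₁_left (z : A ⊗[k] B) : psi₁ k A B (Algebra.TensorProduct.map (AlgHom.id k A)
      (Algebra.TensorProduct.includeLeft : B →ₐ[k] B ⊗[k] B) z) =
    psi₂ k A B (Algebra.TensorProduct.map
      (Algebra.TensorProduct.includeRight : A →ₐ[k] A ⊗[k] A) (AlgHom.id k B) z) := by
  induction z with
  | zero => simp
  | add x y hx hy => simp only [map_add, hx, hy]
  | tmul a b => simp [psi₁_tmul, psi₂_tmul]

theorem psi₁_right (z : A ⊗[k] B) : psi₁ k A B (Algebra.TensorProduct.map (AlgHom.id k A)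
      (Algebra.TensorProduct.includeRight : B →ₐ[k] B ⊗[k] B) z) = (1 : A ⊗[k] B) ⊗ₜ phi z := by
  induction z with
  | zero => simp
  | add x y hx hy => simp only [map_add, hx, hy, TensorProduct.tmul_add]
  | tmul a b => simp [psi₁_tmul, phi_tmul, Algebra.TensorProduct.one_def]

theorem psi₂_left (z : A ⊗[k] B) : psi₂ k A B (Algebra.TensorProduct.map
      (Algebra.TensorProduct.includeLeft : A →ₐ[k] A ⊗[k] A) (AlgHom.id k B) z) =
    Algebra.TensorProduct.assoc k k k _ _ _ (phi z ⊗ₜ (1 : A ⊗[k] B)) := by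
  induction z with
  | zero => simp
  | add x y hx hy => simp only [map_add, hx, hy, TensorProduct.add_tmul]
  | tmul a b => simp [psi₂_tmul, phi_tmul, Algebra.TensorProduct.one_def]

theorem twistComul_coassoc {u : (A ⊗[k] B)ˣ} (hu : IsTwist u) :
    (Algebra.TensorProduct.assoc k k k _ _ _).toAlgHom.comp
      ((Algebra.TensorProduct.map (twistComul u) (.id k _)).comp (twistComul u)) =
    (Algebra.TensorProduct.map (.id k _) (twistComul u)).comp (twistComul u) := by
  refine twist_coassoc _ ?_ (twistComul_eq u)
  simp only [val_mapUnit]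
  rw [map_mul, phi_comul_left, phi_comul_right, hu.comul_left, hu.comul_right, map_mul, map_mul,
    psi₁_left, psi₁_right, psi₂_left, ← mul_assoc, phi_commute, mul_assoc]

theorem twistComul_counit_left {u : (A ⊗[k] B)ˣ} (hu : IsTwist u) :
    (Algebra.TensorProduct.map (Bialgebra.counitAlgHom k (A ⊗[k] B)) (.id k _)).comp (twistComul u) =
      (Algebra.TensorProduct.lid k (A ⊗[k] B)).symm := by
  refine twist_counit_left _ ?_ (twistComul_eq u)
  simp only [val_mapUnit]
  have h : ∀ z : A ⊗[k] B, Algebra.TensorProduct.map (Bialgebra.counitAlgHom k (A ⊗[k] B))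
      (.id k _) (phi z) = 1 ⊗ₜ (TensorProduct.rid k A (Algebra.TensorProduct.map (AlgHom.id k A)
        (Bialgebra.counitAlgHom k B) z) ⊗ₜ 1) := by
    intro z
    induction z with
    | zero => simp
    | add x y hx hy => simp only [map_add, hx, hy, TensorProduct.add_tmul, TensorProduct.tmul_add]
    | tmul a b =>
      rw [phi_tmul, Algebra.TensorProduct.map_tmul]
      simp only [Bialgebra.counitAlgHom_apply, TensorProduct.counit_tmul, AlgHom.id_apply,
        Algebra.TensorProduct.map_tmul, TensorProduct.rid_tmul, Bialgebra.counit_one]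
      rw [TensorProduct.smul_tmul, TensorProduct.smul_tmul']
  rw [h, hu.counit_right]
  simp [Algebra.TensorProduct.one_def]

theorem twistComul_counit_right {u : (A ⊗[k] B)ˣ} (hu : IsTwist u) :
    (Algebra.TensorProduct.map (.id k _) (Bialgebra.counitAlgHom k (A ⊗[k] B))).comp (twistComul u) =
      (Algebra.TensorProduct.rid k k (A ⊗[k] B)).symm := by
  refine twist_counit_right _ ?_ (twistComul_eq u)
  simp only [val_mapUnit]
  have h : ∀ z : A ⊗[k] B, Algebra.TensorProduct.map (.id k _) (Bialgebra.counitAlgHom k (A ⊗[k] B))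
      (phi z) = ((1 : A) ⊗ₜ (TensorProduct.lid k B (Algebra.TensorProduct.map
        (Bialgebra.counitAlgHom k A) (AlgHom.id k B) z))) ⊗ₜ 1 := by
    intro z
    induction z with
    | zero => simp
    | add x y hx hy => simp only [map_add, hx, hy, TensorProduct.add_tmul, TensorProduct.tmul_add]
    | tmul a b =>
      rw [phi_tmul, Algebra.TensorProduct.map_tmul]
      simp only [Bialgebra.counitAlgHom_apply, TensorProduct.counit_tmul, AlgHom.id_apply,
        Algebra.TensorProduct.map_tmul, TensorProduct.lid_tmul, Bialgebra.counit_one]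
      rw [one_smul, TensorProduct.tmul_smul, TensorProduct.smul_tmul, smul_eq_mul, mul_one]
  rw [h, hu.counit_left]
  simp [Algebra.TensorProduct.one_def]

end AB
end twist

section Codouble
variable (k : Type u) [Field k] (H : Type v) [Ring H] [HopfAlgebra k H] [FiniteDimensional k H]

theorem opU_isTwist : IsTwist (opU k H) :=
  ⟨opU_comul_left, opU_comul_right, opU_counit_left, opU_counit_right⟩

/-- The Radford-type codouble: the algebra `H^op ⊗ H^*` with coproduct
`(id ⊗ Σ Ad(U°) ⊗ id) (Δ ⊗ Δ)`, where `U°` is the element `opU k H`. -/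
def Codouble : Type (max u v) := Hᵐᵒᵖ ⊗[k] Dual k H

instance : Ring (Codouble k H) := inferInstanceAs (Ring (Hᵐᵒᵖ ⊗[k] Dual k H))

instance : Algebra k (Codouble k H) := inferInstanceAs (Algebra k (Hᵐᵒᵖ ⊗[k] Dual k H))

/-- The underlying algebra of the codouble is `H^op ⊗ H^*`. -/
def Codouble.equiv : Codouble k H ≃ₐ[k] Hᵐᵒᵖ ⊗[k] Dual k H := AlgEquiv.refl

instance : FiniteDimensional k (Codouble k H) :=
  Module.Finite.equiv (Codouble.equiv k H).symm.toLinearEquiv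

instance codoubleBialgebra : Bialgebra k (Codouble k H) :=
  Bialgebra.ofAlgHom (A := Codouble k H) (R := k)
    (twistComul (opU k H)) (Bialgebra.counitAlgHom k (Hᵐᵒᵖ ⊗[k] Dual k H))
    (twistComul_coassoc (opU_isTwist k H)) (twistComul_counit_left (opU_isTwist k H))
    (twistComul_counit_right (opU_isTwist k H))

end Codouble
end
end DY

namespace DY
open scoped TensorProduct
open Coalgebra
noncomputable section

section Notions
variable {k : Type u} [Field k] {B : Type v} [Ring B] [Bialgebra k B]
  {X : Type w} [Ring X] [Algebra k X]

/-- An algebra homomorphism `α : X → B ⊗ X` is a left coaction of `B` on the algebra `X` if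
`(id ⊗ α) α = (Δ ⊗ id) α` and `(ε ⊗ id) α = id`. -/
structure IsLeftCoaction (α : X →ₐ[k] B ⊗[k] X) : Prop where
  coassoc : ∀ x, α.toLinearMap.lTensor B (α x) =
    TensorProduct.assoc k B B X ((comul (R := k) (A := B)).rTensor X (α x))
  counit_coact : ∀ x, TensorProduct.lid k X ((counit (R := k) (A := B)).rTensor X (α x)) = x

/-- A bilinear map `(x, b) ↦ x ◁ b := ρ x b` makes the algebra `X` a right `B`-module algebra:
`x ◁ 1 = x`, `x ◁ (b c) = (x ◁ b) ◁ c`, `1 ◁ b = ε(b) 1`, `(x y) ◁ b = (x ◁ b₁) (y ◁ b₂)`. -/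
structure IsRightModuleAlgebra (ρ : X →ₗ[k] B →ₗ[k] X) : Prop where
  act_one : ∀ x, ρ x 1 = x
  act_mul : ∀ x b c, ρ x (b * c) = ρ (ρ x b) c
  one_act : ∀ b, ρ 1 b = counit (R := k) b • (1 : X)
  mul_act : ∀ x y b, ρ (x * y) b =
    LinearMap.mul' k X (TensorProduct.map (ρ x) (ρ y) (comul (R := k) b))

/-- The bilinear map `(x, e) ↦ (p(e, ·) ⊗ id) (γ x)` attached to `γ : X → B ⊗ X` and to a
bilinear form `p` on `E × B`. -/
def contract {E : Type*} [AddCommGroup E] [Module k E] (p : E →ₗ[k] B →ₗ[k] k)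
    (γ : X →ₐ[k] B ⊗[k] X) : X →ₗ[k] E →ₗ[k] X :=
  LinearMap.mk₂ k (fun x e => TensorProduct.lid k X ((p e).rTensor X (γ x)))
    (fun x y e => by simp only [map_add])
    (fun c x e => by simp only [map_smul])
    (fun x e f => by simp only [map_add, LinearMap.rTensor_add, LinearMap.add_apply])
    (fun c x e => by simp only [map_smul, LinearMap.rTensor_smul, LinearMap.smul_apply])

theorem contract_apply {E : Type*} [AddCommGroup E] [Module k E] (p : E →ₗ[k] B →ₗ[k] k)
    (γ : X →ₐ[k] B ⊗[k] X) (x : X) (e : E) :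
    contract p γ x e = TensorProduct.lid k X ((p e).rTensor X (γ x)) := rfl

theorem contract_hom {E : Type*} [AddCommGroup E] [Module k E] (p : E →ₗ[k] B →ₗ[k] k)
    {Y : Type*} [Ring Y] [Algebra k Y] {γ : X →ₐ[k] B ⊗[k] X} {δ : Y →ₐ[k] B ⊗[k] Y}
    (f : X →ₐ[k] Y) (hf : ∀ x, δ (f x) = f.toLinearMap.lTensor B (γ x)) (x : X) (e : E) :
    f (contract p γ x e) = contract p δ (f x) e := by
  rw [contract_apply, contract_apply, hf]
  generalize γ x = z
  induction z with
  | zero => simp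
  | add a b ha hb => simp only [map_add, ha, hb]
  | tmul a b => simp

end Notions

section YD
variable {k : Type u} [Field k] {H : Type v} [Ring H] [HopfAlgebra k H]
  {X : Type w} [Ring X] [Algebra k X]

/-- For `α : X → H^op ⊗ X`, the linear map `(op⁻¹ ⊗ id) α : X → H ⊗ X`, `x ↦ x₋₁ ⊗ x₀`. -/
def unopCoact (α : X →ₐ[k] Hᵐᵒᵖ ⊗[k] X) : X →ₗ[k] H ⊗[k] X :=
  (MulOpposite.opLinearEquiv k).symm.toLinearMap.rTensor X ∘ₗ α.toLinearMap

/-- The right-left Yetter-Drinfeld condition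
`x₋₁ h₁ ⊗ (x₀ ◁ h₂) = h₂ (x ◁ h₁)₋₁ ⊗ (x ◁ h₁)₀` in `H ⊗ X`. -/
def IsRightLeftYD (ρ : X →ₗ[k] H →ₗ[k] X) (α : X →ₐ[k] Hᵐᵒᵖ ⊗[k] X) : Prop :=
  ∀ (x : X) (h : H),
    TensorProduct.map (LinearMap.mul' k H) (TensorProduct.lift ρ)
      (TensorProduct.tensorTensorTensorComm k H X H H (unopCoact α x ⊗ₜ comul (R := k) h)) =
    (LinearMap.mul' k H).rTensor X ((TensorProduct.assoc k H H X).symm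
      ((unopCoact α ∘ₗ ρ x).lTensor H (TensorProduct.comm k H H (comul (R := k) h))))

variable [FiniteDimensional k H]

/-- The left-left Yetter-Drinfeld condition
`(id ⊗ α) β = (Σ ⊗ id) (Ad(U°) ⊗ id) (id ⊗ β) α`, where `U°` is `opU k H`. -/
def IsLeftLeftYD (α : X →ₐ[k] Hᵐᵒᵖ ⊗[k] X) (β : X →ₐ[k] Dual k H ⊗[k] X) : Prop :=
  ∀ x : X, α.toLinearMap.lTensor (Dual k H) (β x) =
    TensorProduct.assoc k (Dual k H) Hᵐᵒᵖ X
      ((TensorProduct.comm k Hᵐᵒᵖ (Dual k H)).toLinearMap.rTensor X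
        ((Ad (k := k) (opU k H)).toLinearMap.rTensor X
          ((TensorProduct.assoc k Hᵐᵒᵖ (Dual k H) X).symm
            (β.toLinearMap.lTensor Hᵐᵒᵖ (α x)))))

end YD

section Categories
variable (k : Type u) [Field k]

section ComodAlg
variable (B : Type v) [Ring B] [Bialgebra k B]

/-- The left `B`-comodule algebras. -/
structure LeftComodAlg where
  carrier : Type w
  [ring : Ring carrier]
  [algebra : Algebra k carrier]
  coact : carrier →ₐ[k] B ⊗[k] carrier
  isCoaction : IsLeftCoaction coact

attribute [instance] LeftComodAlg.ring LeftComodAlg.algebra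

variable {k B} in
/-- The homomorphisms of left comodule algebras. -/
@[ext]
structure LeftComodAlg.Hom (M N : LeftComodAlg.{u, v, w} k B) where
  toAlgHom : M.carrier →ₐ[k] N.carrier
  map_coact : ∀ x, N.coact (toAlgHom x) = toAlgHom.toLinearMap.lTensor B (M.coact x)

instance : CategoryTheory.Category (LeftComodAlg.{u, v, w} k B) where
  Hom M N := LeftComodAlg.Hom M N
  id M := ⟨AlgHom.id k M.carrier, fun x => by simp⟩
  comp f g := ⟨g.toAlgHom.comp f.toAlgHom, fun x => by
    rw [AlgHom.comp_apply, g.map_coact, f.map_coact, AlgHom.comp_toLinearMap,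
      LinearMap.lTensor_comp, LinearMap.comp_apply]⟩

/-- The right `B`-module algebras. -/
structure RightModAlg where
  carrier : Type w
  [ring : Ring carrier]
  [algebra : Algebra k carrier]
  act : carrier →ₗ[k] B →ₗ[k] carrier
  isModuleAlgebra : IsRightModuleAlgebra act

attribute [instance] RightModAlg.ring RightModAlg.algebra

variable {k B} in
/-- The homomorphisms of right module algebras. -/
@[ext]
structure RightModAlg.Hom (M N : RightModAlg.{u, v, w} k B) where
  toAlgHom : M.carrier →ₐ[k] N.carrier
  map_act : ∀ x b, toAlgHom (M.act x b) = N.act (toAlgHom x) b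

instance : CategoryTheory.Category (RightModAlg.{u, v, w} k B) where
  Hom M N := RightModAlg.Hom M N
  id M := ⟨AlgHom.id k M.carrier, fun _ _ => rfl⟩
  comp f g := ⟨g.toAlgHom.comp f.toAlgHom, fun x b => by
    rw [AlgHom.comp_apply, f.map_act, g.map_act, AlgHom.comp_apply]⟩

end ComodAlg

section YDAlg
variable (H : Type v) [Ring H] [HopfAlgebra k H]

/-- The right-left Yetter-Drinfeld algebras over `H`: right `H`-module algebras with a left
coaction of `H^op`, subject to the Yetter-Drinfeld condition. -/
structure RightLeftYDAlg where
  carrier : Type w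
  [ring : Ring carrier]
  [algebra : Algebra k carrier]
  act : carrier →ₗ[k] H →ₗ[k] carrier
  coact : carrier →ₐ[k] Hᵐᵒᵖ ⊗[k] carrier
  isModuleAlgebra : IsRightModuleAlgebra act
  isCoaction : IsLeftCoaction coact
  isYD : IsRightLeftYD act coact

attribute [instance] RightLeftYDAlg.ring RightLeftYDAlg.algebra

variable {k H} in
/-- The homomorphisms of right-left Yetter-Drinfeld algebras. -/
@[ext]
structure RightLeftYDAlg.Hom (M N : RightLeftYDAlg.{u, v, w} k H) where
  toAlgHom : M.carrier →ₐ[k] N.carrier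
  map_act : ∀ x h, toAlgHom (M.act x h) = N.act (toAlgHom x) h
  map_coact : ∀ x, N.coact (toAlgHom x) = toAlgHom.toLinearMap.lTensor Hᵐᵒᵖ (M.coact x)

instance : CategoryTheory.Category (RightLeftYDAlg.{u, v, w} k H) where
  Hom M N := RightLeftYDAlg.Hom M N
  id M := ⟨AlgHom.id k M.carrier, fun _ _ => rfl, fun x => by simp⟩
  comp f g := ⟨g.toAlgHom.comp f.toAlgHom, fun x b => by
    rw [AlgHom.comp_apply, f.map_act, g.map_act, AlgHom.comp_apply], fun x => by
    rw [AlgHom.comp_apply, g.map_coact, f.map_coact, AlgHom.comp_toLinearMap,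
      LinearMap.lTensor_comp, LinearMap.comp_apply]⟩

variable [FiniteDimensional k H]

/-- The left-left Yetter-Drinfeld algebras over `H` and its dual. -/
structure LeftLeftYDAlg where
  carrier : Type w
  [ring : Ring carrier]
  [algebra : Algebra k carrier]
  coactα : carrier →ₐ[k] Hᵐᵒᵖ ⊗[k] carrier
  coactβ : carrier →ₐ[k] Dual k H ⊗[k] carrier
  isCoactionα : IsLeftCoaction coactα
  isCoactionβ : IsLeftCoaction coactβ
  isYD : IsLeftLeftYD coactα coactβ

attribute [instance] LeftLeftYDAlg.ring LeftLeftYDAlg.algebra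

variable {k H} in
/-- The homomorphisms of left-left Yetter-Drinfeld algebras. -/
@[ext]
structure LeftLeftYDAlg.Hom (M N : LeftLeftYDAlg.{u, v, w} k H) where
  toAlgHom : M.carrier →ₐ[k] N.carrier
  map_coactα : ∀ x, N.coactα (toAlgHom x) = toAlgHom.toLinearMap.lTensor Hᵐᵒᵖ (M.coactα x)
  map_coactβ : ∀ x, N.coactβ (toAlgHom x) = toAlgHom.toLinearMap.lTensor (Dual k H) (M.coactβ x)

instance : CategoryTheory.Category (LeftLeftYDAlg.{u, v, w} k H) where
  Hom M N := LeftLeftYDAlg.Hom M N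
  id M := ⟨AlgHom.id k M.carrier, fun x => by simp, fun x => by simp⟩
  comp f g := ⟨g.toAlgHom.comp f.toAlgHom, fun x => by
    rw [AlgHom.comp_apply, g.map_coactα, f.map_coactα, AlgHom.comp_toLinearMap,
      LinearMap.lTensor_comp, LinearMap.comp_apply], fun x => by
    rw [AlgHom.comp_apply, g.map_coactβ, f.map_coactβ, AlgHom.comp_toLinearMap,
      LinearMap.lTensor_comp, LinearMap.comp_apply]⟩

end YDAlg
end Categories

section Functors
variable (k : Type u) [Field k] (H : Type v) [Ring H] [HopfAlgebra k H] [FiniteDimensional k H]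

/-- Radford's version of the Drinfeld double: the bialgebra dual to the codouble. -/
abbrev Double : Type (max u v) := Dual k (Codouble k H)

/-- The identification of the vector space `H^* ⊗ H` with the double. -/
def bowtie : Dual k H ⊗[k] H ≃ₗ[k] Double k H :=
  (TensorProduct.congr
    ((ev k H).trans (MulOpposite.opLinearEquiv k).symm.dualMap)
    ((Module.evalEquiv k H).trans (ev k H).dualMap)).trans
  ((TensorProduct.dualDistribEquiv k Hᵐᵒᵖ (Dual k H)).trans
    ((Codouble.equiv k H).toLinearEquiv.dualMap.trans (ev k (Codouble k H)).symm))

variable {k H}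

/-- The pairing of the double with the codouble is
`⟨ω ⋈ h, op c ⊗ θ⟩ = ω(c) θ(h)`. -/
theorem ev_bowtie (ω θ : Dual k H) (h c : H) :
    ev k (Codouble k H) (bowtie k H (ω ⊗ₜ h))
      ((Codouble.equiv k H).symm (MulOpposite.op c ⊗ₜ θ)) = ev k H ω c * ev k H θ h := by
  simp [bowtie, TensorProduct.dualDistribEquiv, TensorProduct.dualDistribEquivOfBasis]

section Maps
variable {X : Type w} [Ring X] [Algebra k X]

/-- The algebra homomorphism `γ = (id ⊗ β) α`, with values in `(H^op ⊗ H^*) ⊗ X`. -/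
def gammaMap (α : X →ₐ[k] Hᵐᵒᵖ ⊗[k] X) (β : X →ₐ[k] Dual k H ⊗[k] X) :
    X →ₐ[k] Codouble k H ⊗[k] X :=
  (Algebra.TensorProduct.map (Codouble.equiv k H).symm.toAlgHom (AlgHom.id k X)).comp
    ((Algebra.TensorProduct.assoc k k k Hᵐᵒᵖ (Dual k H) X).symm.toAlgHom.comp
      ((Algebra.TensorProduct.map (AlgHom.id k Hᵐᵒᵖ) β).comp α))

/-- The bilinear map `x ◁_β h = (⟨h, ·⟩ ⊗ id) (β x)`, where `⟨h, θ⟩ = θ(h)`. -/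
def actβ (β : X →ₐ[k] Dual k H ⊗[k] X) : X →ₗ[k] H →ₗ[k] X :=
  contract (ev k H).toLinearMap.flip β

/-- The bilinear map `x ◁_α ω = ω(x₋₁) x₀`, where `α x = op x₋₁ ⊗ x₀`. -/
def actα (α : X →ₐ[k] Hᵐᵒᵖ ⊗[k] X) : X →ₗ[k] Dual k H →ₗ[k] X :=
  contract (LinearMap.lcomp k k (MulOpposite.opLinearEquiv k).symm.toLinearMap ∘ₗ
    (ev k H).toLinearMap) α

/-- The bilinear map `x ◁_γ d = (⟨d, ·⟩ ⊗ id) (γ x)` for `d` in the double. -/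
def actγ (γ : X →ₐ[k] Codouble k H ⊗[k] X) : X →ₗ[k] Double k H →ₗ[k] X :=
  contract (ev k (Codouble k H)).toLinearMap γ

/-- The bilinear map on `X` and the double given by `x · (ω ⋈ h) = (x ◁_α ω) ◁ h`. -/
def radfordAct (ρ : X →ₗ[k] H →ₗ[k] X) (α : X →ₐ[k] Hᵐᵒᵖ ⊗[k] X) :
    X →ₗ[k] Double k H →ₗ[k] X :=
  LinearMap.mk₂ k (fun x d => TensorProduct.lift (ρ ∘ₗ actα α x) ((bowtie k H).symm d))
    (fun x y d => by
      rw [map_add, LinearMap.comp_add]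
      generalize (bowtie k H).symm d = z
      induction z with
      | zero => simp
      | add a b ha hb => simp only [map_add, ha, hb]; abel
      | tmul a b => simp)
    (fun c x d => by
      rw [map_smul, LinearMap.comp_smul]
      generalize (bowtie k H).symm d = z
      induction z with
      | zero => simp
      | add a b ha hb => simp only [map_add, ha, hb, smul_add]
      | tmul a b => simp)
    (fun x d e => by simp only [map_add])
    (fun c x d => by simp only [map_smul])

theorem radfordAct_bowtie (ρ : X →ₗ[k] H →ₗ[k] X) (α : X →ₐ[k] Hᵐᵒᵖ ⊗[k] X) (x : X)
    (ω : Dual k H) (h : H) :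
    radfordAct ρ α x (bowtie k H (ω ⊗ₜ h)) = ρ (actα α x ω) h := by
  simp [radfordAct]

theorem gammaMap_hom {Y : Type*} [Ring Y] [Algebra k Y] {α : X →ₐ[k] Hᵐᵒᵖ ⊗[k] X}
    {β : X →ₐ[k] Dual k H ⊗[k] X} {α' : Y →ₐ[k] Hᵐᵒᵖ ⊗[k] Y} {β' : Y →ₐ[k] Dual k H ⊗[k] Y}
    (f : X →ₐ[k] Y) (hα : ∀ x, α' (f x) = f.toLinearMap.lTensor Hᵐᵒᵖ (α x))
    (hβ : ∀ x, β' (f x) = f.toLinearMap.lTensor (Dual k H) (β x)) (x : X) :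
    gammaMap α' β' (f x) = f.toLinearMap.lTensor (Codouble k H) (gammaMap α β x) := by
  simp only [gammaMap, AlgHom.comp_apply, hα]
  generalize α x = z
  induction z with
  | zero => simp
  | add a b ha hb => simp only [map_add, ha, hb]
  | tmul a b =>
    simp only [LinearMap.lTensor_tmul, Algebra.TensorProduct.map_tmul, AlgHom.toLinearMap_apply, hβ]
    generalize β b = z
    induction z with
    | zero => simp
    | add a b ha hb => simp only [TensorProduct.tmul_add, map_add, ha, hb]
    | tmul c d => simp

theorem radfordAct_hom {Y : Type*} [Ring Y] [Algebra k Y] {ρ : X →ₗ[k] H →ₗ[k] X}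
    {α : X →ₐ[k] Hᵐᵒᵖ ⊗[k] X} {ρ' : Y →ₗ[k] H →ₗ[k] Y} {α' : Y →ₐ[k] Hᵐᵒᵖ ⊗[k] Y}
    (f : X →ₐ[k] Y) (hρ : ∀ x h, f (ρ x h) = ρ' (f x) h)
    (hα : ∀ x, α' (f x) = f.toLinearMap.lTensor Hᵐᵒᵖ (α x)) (x : X) (d : Double k H) :
    f (radfordAct ρ α x d) = radfordAct ρ' α' (f x) d := by
  obtain ⟨z, rfl⟩ := (bowtie k H).surjective d
  induction z with
  | zero => simp
  | add a b ha hb => simp only [map_add, ha, hb]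
  | tmul a b => rw [radfordAct_bowtie, radfordAct_bowtie, hρ, actα, actα, contract_hom _ f hα]

end Maps

/-- The functor `(X, α, β) ↦ (X, (id ⊗ β) α)`, `f ↦ f`. -/
def toComodAlg (h : ∀ M : LeftLeftYDAlg.{u, v, w} k H,
      IsLeftCoaction (gammaMap M.coactα M.coactβ)) :
    CategoryTheory.Functor (LeftLeftYDAlg.{u, v, w} k H) (LeftComodAlg.{u, max u v, w} k (Codouble k H)) where
  obj M := ⟨M.carrier, gammaMap M.coactα M.coactβ, h M⟩
  map f := ⟨f.toAlgHom, gammaMap_hom f.toAlgHom f.map_coactα f.map_coactβ⟩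

/-- The functor `(X, α, β) ↦ (X, ◁_β, α)`, `f ↦ f`. -/
def toRightLeftYD (h : ∀ M : LeftLeftYDAlg.{u, v, w} k H,
      IsRightModuleAlgebra (actβ M.coactβ) ∧ IsRightLeftYD (actβ M.coactβ) M.coactα) :
    CategoryTheory.Functor (LeftLeftYDAlg.{u, v, w} k H) (RightLeftYDAlg.{u, v, w} k H) where
  obj M := ⟨M.carrier, actβ M.coactβ, M.coactα, (h M).1, M.isCoactionα, (h M).2⟩
  map f := ⟨f.toAlgHom, contract_hom _ f.toAlgHom f.map_coactβ, f.map_coactα⟩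

/-- The functor `(X, γ) ↦ (X, ◁_γ)`, `f ↦ f`. -/
def toRightModAlg (h : ∀ N : LeftComodAlg.{u, max u v, w} k (Codouble k H),
      IsRightModuleAlgebra (actγ N.coact)) :
    CategoryTheory.Functor (LeftComodAlg.{u, max u v, w} k (Codouble k H))
      (RightModAlg.{u, max u v, w} k (Double k H)) where
  obj N := ⟨N.carrier, actγ N.coact, h N⟩
  map f := ⟨f.toAlgHom, contract_hom _ f.toAlgHom f.map_coact⟩

/-- The functor `(X, ◁, α) ↦ (X, ·)` with `x · (ω ⋈ h) = (x ◁_α ω) ◁ h`, `f ↦ f`. -/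
def radfordFunctor (h : ∀ Y : RightLeftYDAlg.{u, v, w} k H,
      IsRightModuleAlgebra (radfordAct Y.act Y.coact)) :
    CategoryTheory.Functor (RightLeftYDAlg.{u, v, w} k H)
      (RightModAlg.{u, max u v, w} k (Double k H)) where
  obj Y := ⟨Y.carrier, radfordAct Y.act Y.coact, h Y⟩
  map f := ⟨f.toAlgHom, radfordAct_hom f.toAlgHom f.map_act f.map_coact⟩

end Functors
end
end DY

open scoped CategoryTheory

/-! Write T for the codouble with coproduct `Δ_T`, U for `opU k H`, ◁ for a right action, and π_L =
id ⊗ ε, π_R = ε ⊗ id for the projections of T onto H^op and H^*.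

Duality. If E and B are finite-dimensional bialgebras in perfect Hopf pairing, then B ⊗ V ≅ Hom(E,
V), so a linear map X → B ⊗ X is the same as a bilinear map X × E → X. Under this dictionary
coassociativity and counitality become associativity and unitality of a right action, while being an
algebra homomorphism becomes the module algebra compatibility. Applied to T and its dual, it gives
the equivalence between T-comodule algebras and modules over the double. Applied to H^* and H, it
turns β into ◁_β. There the Yetter-Drinfeld condition must also be translated: writing Ad(U) z = y
as y (U ⊗ 1) = (U ⊗ 1) z and evaluating the H^*-leg at h, where U evaluates to op h, gives exactly
the right-left condition (`isLeftLeftYD_iff`).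

Codouble. The passage from (α, β) to γ = (id ⊗ β) α rests on four identities. The maps π_L and π_R
respect coproducts, (π_L ⊗ π_R) `Δ_T` = id, and (π_R ⊗ π_L) `Δ_T` = Σ Ad(U). In the first three the
conjugation disappears because U becomes 1 when a counit is applied to either leg. Given γ, pushing
it forward along π_L and π_R yields coactions α and β; the third identity says that they recombine
to γ, and the fourth is their Yetter-Drinfeld condition. Conversely, that condition is what makes
(id ⊗ β) α coassociative for the twisted coproduct (`combine_coassoc`), and the counits recover α
and β from γ.

Square. On ω ⋈ h both composites give (ω(x₋₁) x₀) ◁_β h, so the square commutes (`radfordAct_actβ`).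
Every right-left Yetter-Drinfeld algebra is literally the image of a left-left one. Hence the module
algebra axioms for the action of the double need no computation, and the fourth functor is an
equivalence because the other three are. -/

namespace DY
open scoped TensorProduct
open Coalgebra
noncomputable section

/-! ### Coactions of a bialgebra and actions of its dual. -/

section Pairing
variable {k : Type u} [Field k] {E B : Type*} [Ring E] [Bialgebra k E] [Ring B] [Bialgebra k B]
  [FiniteDimensional k E] [FiniteDimensional k B]

/-- A linear isomorphism from `E` onto the linear forms on `B` that is a Hopf pairing. -/
structure IsPerfectPairing (p : E ≃ₗ[k] (B →ₗ[k] k)) : Prop where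
  mul_left : ∀ e f b, p (e * f) b =
    LinearMap.mul' k k (TensorProduct.map (p e) (p f) (comul (R := k) b))
  one_left : ∀ b, p 1 b = counit (R := k) b
  mul_right : ∀ e b c, p e (b * c) = LinearMap.mul' k k (TensorProduct.map
    (p.toLinearMap.flip b) (p.toLinearMap.flip c) (comul (R := k) e))
  one_right : ∀ e, p e 1 = counit (R := k) e

/-- The isomorphism from `B ⊗ V` onto the linear maps `E → V` attached to a pairing. -/
def tensorEquivHom (p : E ≃ₗ[k] (B →ₗ[k] k)) (V : Type*) [AddCommGroup V] [Module k V] :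
    B ⊗[k] V ≃ₗ[k] (E →ₗ[k] V) :=
  (TensorProduct.congr ((Module.evalEquiv k B).trans p.dualMap) (LinearEquiv.refl k V)).trans
    (dualTensorHomEquiv k E V)

variable (p : E ≃ₗ[k] (B →ₗ[k] k))

@[simp] theorem tensorEquivHom_tmul {V : Type*} [AddCommGroup V] [Module k V] (b : B) (v : V)
    (e : E) : tensorEquivHom p V (b ⊗ₜ v) e = p e b • v := by
  simp [tensorEquivHom, dualTensorHomEquiv]

theorem tensorEquivHom_apply {V : Type*} [AddCommGroup V] [Module k V] (z : B ⊗[k] V) (e : E) :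
    tensorEquivHom p V z e = TensorProduct.lid k V ((p e).rTensor V z) := by
  induction z with
  | zero => simp
  | add x y hx hy => simp only [map_add, LinearMap.add_apply, hx, hy]
  | tmul b v => simp

theorem tensorEquivHom_lTensor {V W : Type*} [AddCommGroup V] [Module k V] [AddCommGroup W]
    [Module k W] (g : V →ₗ[k] W) (z : B ⊗[k] V) (e : E) :
    tensorEquivHom p W (g.lTensor B z) e = g (tensorEquivHom p V z e) := by
  induction z with
  | zero => simp
  | add x y hx hy => simp only [map_add, LinearMap.add_apply, hx, hy]
  | tmul b v => simp

variable {p}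

/-- The product of E is dual to the coproduct of B. The element e meets the first tensor leg and f
the second, which is why left coactions give right actions. -/
theorem IsPerfectPairing.tensorEquivHom_comul (hp : IsPerfectPairing p) {V : Type*}
    [AddCommGroup V] [Module k V] (z : B ⊗[k] V) (e f : E) :
    tensorEquivHom p V (tensorEquivHom p (B ⊗[k] V)
      (TensorProduct.assoc k B B V ((comul (R := k) (A := B)).rTensor V z)) e) f =
    tensorEquivHom p V z (e * f) := by
  induction z with
  | zero => simp
  | add x y hx hy => simp only [map_add, LinearMap.add_apply, hx, hy]
  | tmul b v =>
    rw [tensorEquivHom_tmul, hp.mul_left, LinearMap.rTensor_tmul]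
    generalize comul (R := k) b = w
    induction w with
    | zero => simp
    | add x y hx hy => simp only [TensorProduct.add_tmul, map_add, LinearMap.add_apply, hx, hy,
        add_smul]
    | tmul x y => simp [smul_smul]

theorem IsPerfectPairing.tensorEquivHom_counit (hp : IsPerfectPairing p) {V : Type*}
    [AddCommGroup V] [Module k V] (z : B ⊗[k] V) :
    TensorProduct.lid k V ((counit (R := k) (A := B)).rTensor V z) = tensorEquivHom p V z 1 := by
  rw [tensorEquivHom_apply]
  congr 3
  ext b
  exact (hp.one_left b).symm

/-- The coproduct of E is dual to the product of B, so the algebra B ⊗ V is the convolution algebra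
Hom(E, V). -/
theorem IsPerfectPairing.tensorEquivHom_mul (hp : IsPerfectPairing p) {V : Type*} [Ring V]
    [Algebra k V] (z w : B ⊗[k] V) (e : E) : tensorEquivHom p V (z * w) e =
    LinearMap.mul' k V (TensorProduct.map (tensorEquivHom p V z) (tensorEquivHom p V w)
      (comul (R := k) e)) := by
  induction z with
  | zero => simp
  | add x y hx hy =>
    simp only [add_mul, map_add, LinearMap.add_apply, hx, hy, TensorProduct.map_add_left]
  | tmul a x =>
    induction w with
    | zero => simp
    | add x y hx hy =>
      simp only [mul_add, map_add, LinearMap.add_apply, hx, hy, TensorProduct.map_add_right]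
    | tmul b y =>
      rw [Algebra.TensorProduct.tmul_mul_tmul, tensorEquivHom_tmul, hp.mul_right]
      generalize comul (R := k) e = t
      induction t with
      | zero => simp
      | add x y hx hy => simp only [map_add, add_smul, hx, hy]
      | tmul x y => simp [smul_smul, mul_comm]

variable {X : Type w} [Ring X] [Algebra k X]

theorem contract_eq (γ : X →ₐ[k] B ⊗[k] X) (x : X) :
    contract p.toLinearMap γ x = tensorEquivHom p X (γ x) := by
  ext e
  rw [contract_apply, tensorEquivHom_apply]
  rfl

/-- Coassociativity corresponds to associativity of the action and counitality to x ◁ 1 = x. The two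
remaining axioms hold on both sides because γ is multiplicative and unital. -/
theorem IsPerfectPairing.isRightModuleAlgebra_contract_iff (hp : IsPerfectPairing p)
    (γ : X →ₐ[k] B ⊗[k] X) :
    IsRightModuleAlgebra (contract p.toLinearMap γ) ↔ IsLeftCoaction γ := by
  have key : ∀ x e f, tensorEquivHom p X (tensorEquivHom p _ (γ.toLinearMap.lTensor B (γ x)) e) f =
      contract p.toLinearMap γ (contract p.toLinearMap γ x e) f := by
    intro x e f
    rw [tensorEquivHom_lTensor, contract_eq, contract_eq]
    rfl
  constructor
  · intro h
    refine ⟨fun x => ?_, fun x => ?_⟩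
    -- An element of B ⊗ (B ⊗ X) is determined by its evaluations at all pairs (e, f).
    · apply (tensorEquivHom p _).injective
      ext e
      apply (tensorEquivHom p _).injective
      ext f
      rw [key, hp.tensorEquivHom_comul, ← h.act_mul, contract_eq]
    · rw [hp.tensorEquivHom_counit, ← contract_eq, h.act_one]
  · intro h
    refine ⟨fun x => ?_, fun x e f => ?_, fun e => ?_, fun x y e => ?_⟩
    · rw [contract_eq, ← hp.tensorEquivHom_counit, h.counit_coact]
    · rw [← key, h.coassoc, hp.tensorEquivHom_comul, contract_eq]
    · rw [contract_eq, map_one, Algebra.TensorProduct.one_def, tensorEquivHom_tmul, hp.one_right]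
    · rw [contract_eq, map_mul, hp.tensorEquivHom_mul, contract_eq, contract_eq]

/-- The isomorphism B ⊗ X ≅ Hom(E, X) provides γ as a linear map; 1 ◁ e = ε(e) 1 and the rule for (x
y) ◁ e make it an algebra homomorphism. -/
theorem IsPerfectPairing.exists_contract_eq (hp : IsPerfectPairing p) {ρ : X →ₗ[k] E →ₗ[k] X}
    (h : IsRightModuleAlgebra ρ) : ∃ γ : X →ₐ[k] B ⊗[k] X, contract p.toLinearMap γ = ρ := by
  refine ⟨AlgHom.ofLinearMap ((tensorEquivHom p X).symm.toLinearMap ∘ₗ ρ) ?_ fun x y => ?_, ?_⟩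
  · apply (tensorEquivHom p X).injective
    ext e
    simp [Algebra.TensorProduct.one_def, h.one_act, hp.one_right]
  · apply (tensorEquivHom p X).injective
    ext e
    rw [hp.tensorEquivHom_mul]
    simp [h.mul_act]
  · ext x : 1
    rw [contract_eq]
    simp

/-- Nondegeneracy of the pairing: this is the source of fullness for the functors from coactions to
actions. -/
theorem map_coact_of_map_contract {Y : Type*} [Ring Y] [Algebra k Y] {γ : X →ₐ[k] B ⊗[k] X}
    {δ : Y →ₐ[k] B ⊗[k] Y} (f : X →ₐ[k] Y)
    (hf : ∀ x e, f (contract p.toLinearMap γ x e) = contract p.toLinearMap δ (f x) e) (x : X) :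
    δ (f x) = f.toLinearMap.lTensor B (γ x) := by
  apply (tensorEquivHom p Y).injective
  ext e
  rw [tensorEquivHom_lTensor, ← contract_eq, ← contract_eq, ← hf]
  rfl

end Pairing

/-! ### The evaluation pairing of a bialgebra with its dual, read in both directions. -/

section Instances
variable (k : Type u) [Field k] (B : Type v) [Ring B] [Bialgebra k B] [FiniteDimensional k B]

/-- Used for the double acting and the codouble coacting. -/
theorem isPerfectPairing_ev : IsPerfectPairing (ev k B) where
  mul_left := ev_mul
  one_left := ev_one
  mul_right e b c := by
    rw [← pair_dualComul]
    change _ = LinearMap.mul' k k (TensorProduct.map _ _ (dualComul e))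
    generalize dualComul e = z
    induction z with
    | zero => simp
    | add x y hx hy => simp only [map_add, LinearMap.add_apply, hx, hy]
    | tmul x y => simp
  one_right _ := rfl

/-- The pairing of `B` with its dual, as an isomorphism onto the linear forms on the dual. -/
def evFlip : B ≃ₗ[k] (Dual k B →ₗ[k] k) := (Module.evalEquiv k B).trans (ev k B).dualMap

theorem toLinearMap_evFlip : (evFlip k B).toLinearMap = (ev k B).toLinearMap.flip := by
  ext; simp [evFlip]

@[simp] theorem evFlip_apply (b : B) (θ : Dual k B) : evFlip k B b θ = ev k B θ b := by
  simp [evFlip]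

/-- Used for H acting and its dual coacting. -/
theorem isPerfectPairing_evFlip : IsPerfectPairing (evFlip k B) where
  mul_left e f θ := by
    rw [evFlip_apply, ← pair_dualComul]
    change _ = LinearMap.mul' k k (TensorProduct.map _ _ (dualComul θ))
    generalize dualComul θ = z
    induction z with
    | zero => simp
    | add x y hx hy => simp only [map_add, LinearMap.add_apply, hx, hy]
    | tmul x y => simp
  one_left θ := by rw [evFlip_apply]; rfl
  mul_right e θ η := by
    rw [evFlip_apply, ev_mul]
    congr 3
  one_right e := by rw [evFlip_apply, ev_one]

end Instances
end
end DY

namespace DY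
open scoped TensorProduct
open Coalgebra
noncomputable section

/-! ### Equivalence of the left-left and right-left Yetter-Drinfeld conditions. -/

section YetterDrinfeld
variable {k : Type u} [Field k] {H : Type v} [Ring H] [HopfAlgebra k H] [FiniteDimensional k H]
  {X : Type w} [Ring X] [Algebra k X]

/-- The isomorphism from `(H^op ⊗ H^*) ⊗ X` onto the linear maps `H → H^op ⊗ X`. -/
def conLeft : (Hᵐᵒᵖ ⊗[k] Dual k H) ⊗[k] X ≃ₗ[k] (H →ₗ[k] Hᵐᵒᵖ ⊗[k] X) :=
  ((TensorProduct.congr (TensorProduct.comm k Hᵐᵒᵖ (Dual k H)) (LinearEquiv.refl k X)).trans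
    (TensorProduct.assoc k (Dual k H) Hᵐᵒᵖ X)).trans (tensorEquivHom (evFlip k H) (Hᵐᵒᵖ ⊗[k] X))

theorem conLeft_apply (z : (Hᵐᵒᵖ ⊗[k] Dual k H) ⊗[k] X) : conLeft z =
    tensorEquivHom (evFlip k H) _ (TensorProduct.assoc k (Dual k H) Hᵐᵒᵖ X
      ((TensorProduct.comm k Hᵐᵒᵖ (Dual k H)).toLinearMap.rTensor X z)) := rfl

@[simp] theorem conLeft_tmul (a : Hᵐᵒᵖ) (θ : Dual k H) (x : X) (h : H) :
    conLeft ((a ⊗ₜ[k] θ) ⊗ₜ[k] x) h = ev k H θ h • (a ⊗ₜ x) := by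
  simp [conLeft_apply]

/-- Flipping and reassociating tensor factors are algebra homomorphisms, so `conLeft` turns products
into convolution products. -/
theorem conLeft_mul (z w : (Hᵐᵒᵖ ⊗[k] Dual k H) ⊗[k] X) (h : H) : conLeft (z * w) h =
    LinearMap.mul' k _ (TensorProduct.map (conLeft z) (conLeft w) (comul (R := k) h)) := by
  let F := (Algebra.TensorProduct.assoc k k k (Dual k H) Hᵐᵒᵖ X).toAlgHom.comp
    (Algebra.TensorProduct.map (Algebra.TensorProduct.comm k Hᵐᵒᵖ (Dual k H)).toAlgHom
      (AlgHom.id k X))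
  have e : ∀ z, conLeft z = tensorEquivHom (evFlip k H) (Hᵐᵒᵖ ⊗[k] X) (F z) := fun _ => rfl
  rw [e, e, e, map_mul, (isPerfectPairing_evFlip k H).tensorEquivHom_mul]

theorem conLeft_tmul_one (z : Hᵐᵒᵖ ⊗[k] Dual k H) (h : H) :
    conLeft (z ⊗ₜ[k] (1 : X)) h = con k H Hᵐᵒᵖ z h ⊗ₜ 1 := by
  induction z with
  | zero => simp
  | add x y hx hy => simp only [TensorProduct.add_tmul, map_add, LinearMap.add_apply, hx, hy]
  | tmul a θ => simp [TensorProduct.smul_tmul']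

/-- Evaluating the H^*-leg created by β at h is the action of h on the X-leg. -/
theorem conLeft_lTensor (β : X →ₐ[k] Dual k H ⊗[k] X) (z : Hᵐᵒᵖ ⊗[k] X) (h : H) :
    conLeft ((TensorProduct.assoc k Hᵐᵒᵖ (Dual k H) X).symm (β.toLinearMap.lTensor Hᵐᵒᵖ z)) h =
      ((contract (evFlip k H).toLinearMap β).flip h).lTensor Hᵐᵒᵖ z := by
  induction z with
  | zero => simp
  | add x y hx hy => simp only [map_add, LinearMap.add_apply, hx, hy]
  | tmul a x =>
    rw [LinearMap.lTensor_tmul, LinearMap.lTensor_tmul, LinearMap.flip_apply, contract_eq,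
      AlgHom.toLinearMap_apply]
    generalize β x = t
    induction t with
    | zero => simp
    | add x y hx hy =>
      simp only [TensorProduct.tmul_add, map_add, LinearMap.add_apply, hx, hy]
    | tmul θ x => simp [TensorProduct.tmul_smul]

theorem rTensor_Ad_mul {R : Type*} [Ring R] [Algebra k R] (u : Rˣ) (z : R ⊗[k] X) :
    (Ad (k := k) u).toLinearMap.rTensor X z * (u.val ⊗ₜ 1) = (u.val ⊗ₜ 1) * z := by
  induction z with
  | zero => simp
  | add x y hx hy => simp only [map_add, add_mul, mul_add, hx, hy]
  | tmul a x => simp [Ad_apply]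

/-- Clears the inverse of u, so that the antipode hidden in the inverse of `opU k H` never enters.
-/
theorem eq_rTensor_Ad_iff {R : Type*} [Ring R] [Algebra k R] (u : Rˣ) (y z : R ⊗[k] X) :
    y = (Ad (k := k) u).toLinearMap.rTensor X z ↔ y * (u.val ⊗ₜ 1) = (u.val ⊗ₜ 1) * z := by
  rw [← rTensor_Ad_mul]
  have : IsUnit (u.val ⊗ₜ[k] (1 : X)) :=
    (mapUnit (k := k) (Algebra.TensorProduct.includeLeft : R →ₐ[k] R ⊗[k] X) u).isUnit
  exact this.mul_left_inj.symm

/-- With the inverse of U cleared, the left-left condition equates two products in (H^op ⊗ H^*) ⊗ X.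
Under `conLeft` these are convolution products involving h ↦ op h ⊗ 1, and their values at h are the
two sides of the right-left condition. -/
theorem isLeftLeftYD_iff (α : X →ₐ[k] Hᵐᵒᵖ ⊗[k] X) (β : X →ₐ[k] Dual k H ⊗[k] X) :
    IsLeftLeftYD α β ↔ IsRightLeftYD (contract (evFlip k H).toLinearMap β) α := by
  set ρ := contract (evFlip k H).toLinearMap β with hρ
  unfold IsLeftLeftYD IsRightLeftYD
  refine forall_congr' fun x => ?_
  -- Moves the flip to the other side: (id ⊗ α) β x corresponds to the map h ↦ α (x ◁ h).
  have h1 : ∀ z : (Hᵐᵒᵖ ⊗[k] Dual k H) ⊗[k] X,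
      α.toLinearMap.lTensor (Dual k H) (β x) = TensorProduct.assoc k (Dual k H) Hᵐᵒᵖ X
        ((TensorProduct.comm k Hᵐᵒᵖ (Dual k H)).toLinearMap.rTensor X z) ↔
      conLeft.symm (α.toLinearMap ∘ₗ ρ x) = z := by
    intro z
    rw [LinearEquiv.symm_apply_eq, conLeft_apply, ← (tensorEquivHom (evFlip k H) _).injective.eq_iff]
    refine Eq.congr ?_ rfl
    ext h
    rw [tensorEquivHom_lTensor, hρ, contract_eq]
    rfl
  rw [h1, eq_rTensor_Ad_iff, ← conLeft.injective.eq_iff, LinearMap.ext_iff]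
  refine forall_congr' fun h => ?_
  rw [conLeft_mul, conLeft_mul, LinearEquiv.apply_symm_apply,
    ← (LinearEquiv.rTensor X (MulOpposite.opLinearEquiv k (M := H))).injective.eq_iff, eq_comm]
  have hU : ∀ h, conLeft ((opU k H).val ⊗ₜ[k] (1 : X)) h = MulOpposite.op h ⊗ₜ 1 := by
    intro h
    rw [conLeft_tmul_one, con_opU]
    rfl
  refine Eq.congr ?_ ?_
  -- The factor from U stands on the left: (op h₁ ⊗ 1)(op x₋₁ ⊗ (x₀ ◁ h₂)) = op (x₋₁ h₁) ⊗ (x₀ ◁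
  -- h₂), the order being reversed by op.
  · generalize comul (R := k) h = w
    induction w with
    | zero => simp
    | add x y hx hy => simp only [TensorProduct.tmul_add, map_add, hx, hy]
    | tmul g h =>
      rw [TensorProduct.map_tmul, LinearMap.mul'_apply, hU, conLeft_lTensor, ← hρ]
      simp only [unopCoact, LinearMap.comp_apply, AlgHom.toLinearMap_apply]
      generalize α x = z
      induction z with
      | zero => simp
      | add x y hx hy => simp only [TensorProduct.add_tmul, map_add, mul_add, hx, hy]
      | tmul a y => simp [LinearEquiv.rTensor]
  -- Here the factor from U stands on the right: α (x ◁ h₁)(op h₂ ⊗ 1) has H-component h₂ (x ◁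
  -- h₁)₋₁.
  · generalize comul (R := k) h = w
    induction w with
    | zero => simp
    | add x y hx hy => simp only [map_add, hx, hy]
    | tmul g h =>
      rw [TensorProduct.map_tmul, LinearMap.mul'_apply, hU]
      simp only [TensorProduct.comm_tmul, LinearMap.lTensor_tmul, unopCoact, LinearMap.comp_apply,
        AlgHom.toLinearMap_apply]
      generalize α (ρ x g) = z
      induction z with
      | zero => simp
      | add x y hx hy => simp only [TensorProduct.tmul_add, map_add, add_mul, hx, hy]
      | tmul a y => simp [LinearEquiv.rTensor]

end YetterDrinfeld
end
end DY

namespace DY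
open scoped TensorProduct
open Coalgebra
noncomputable section

/-! ### The twisted coproduct on A ⊗ B seen through the two projections. -/

section TwistedCoactions
variable {k : Type u} [Field k] {A : Type*} {B : Type*} [Ring A] [Bialgebra k A] [Ring B]
  [Bialgebra k B]

variable (k A B) in
/-- The map `id ⊗ ε` on `A ⊗ B`. -/
def projLeft : A ⊗[k] B →ₐ[k] A :=
  (Algebra.TensorProduct.rid k k A).toAlgHom.comp
    (Algebra.TensorProduct.map (AlgHom.id k A) (Bialgebra.counitAlgHom k B))

variable (k A B) in
/-- The map `ε ⊗ id` on `A ⊗ B`. -/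
def projRight : A ⊗[k] B →ₐ[k] B :=
  (Algebra.TensorProduct.lid k B).toAlgHom.comp
    (Algebra.TensorProduct.map (Bialgebra.counitAlgHom k A) (AlgHom.id k B))

@[simp] theorem projLeft_tmul (a : A) (b : B) :
    projLeft k A B (a ⊗ₜ b) = counit (R := k) b • a := by simp [projLeft]

@[simp] theorem projRight_tmul (a : A) (b : B) :
    projRight k A B (a ⊗ₜ b) = counit (R := k) a • b := by simp [projRight]

/-- Algebra homomorphisms carry conjugation to conjugation. After applying f, the effect of the
twist depends only on the image of u under f ∘ `phi`. -/
theorem map_comp_twistComul {R : Type*} [Ring R] [Algebra k R] (f : (A ⊗[k] B) ⊗[k] (A ⊗[k] B) →ₐ[k] R)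
    (u : (A ⊗[k] B)ˣ) (z : A ⊗[k] B) :
    f (twistComul u z) = Ad (k := k) (mapUnit (f.comp phi) u) (f (comul (R := k) z)) := by
  have := DFunLike.congr_fun (comp_Ad f (mapUnit phi u)) (comul (R := k) z)
  rw [twistComul_eq]
  exact this

theorem Ad_one {R : Type*} [Ring R] [Algebra k R] : Ad (k := k) (1 : Rˣ) = AlgHom.id k R := by
  ext x; simp [Ad_apply]

theorem IsTwist.projLeft_val {u : (A ⊗[k] B)ˣ} (hu : IsTwist u) : projLeft k A B u.val = 1 := by
  rw [projLeft, AlgHom.comp_apply, hu.counit_right, map_one]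

theorem IsTwist.projRight_val {u : (A ⊗[k] B)ˣ} (hu : IsTwist u) : projRight k A B u.val = 1 := by
  rw [projRight, AlgHom.comp_apply, hu.counit_left, map_one]

theorem map_counit_counit_comul (b : B) :
    LinearMap.mul' k k (TensorProduct.map (counit (R := k)) (counit (R := k))
      (comul (R := k) b)) = counit (R := k) b := by
  have h := congrArg (fun z => counit (R := k) (TensorProduct.lid k B z))
    (Coalgebra.rTensor_counit_comul (R := k) b)
  simp only [TensorProduct.lid_tmul, one_smul] at h
  rw [← h]
  generalize comul (R := k) b = z
  induction z with
  | zero => simp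
  | add x y hx hy => simp only [map_add, hx, hy]
  | tmul x y => simp

/-- Since `phi` sends a ⊗ b to (1 ⊗ b) ⊗ (a ⊗ 1), the two projections reduce it to 1 ⊗ ε(b) a. On u
this is 1 by the counit condition, so the conjugation is trivial and the untwisted computation
remains. -/
theorem IsTwist.map_projLeft_projLeft {u : (A ⊗[k] B)ˣ} (hu : IsTwist u) (z : A ⊗[k] B) :
    Algebra.TensorProduct.map (projLeft k A B) (projLeft k A B) (twistComul u z) =
      comul (R := k) (projLeft k A B z) := by
  have e : mapUnit ((Algebra.TensorProduct.map (projLeft k A B) (projLeft k A B)).comp phi) u =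
      1 := by
    apply Units.ext
    have : (Algebra.TensorProduct.map (projLeft k A B) (projLeft k A B)).comp phi =
        Algebra.TensorProduct.includeRight.comp (projLeft k A B) := by
      ext <;> simp [phi_tmul, TensorProduct.smul_tmul']
    rw [val_mapUnit, this, AlgHom.comp_apply, hu.projLeft_val, map_one, Units.val_one]
  rw [map_comp_twistComul, e, Ad_one, AlgHom.id_apply]
  induction z with
  | zero => simp
  | add x y hx hy => simp only [map_add, hx, hy]
  | tmul a b =>
    rw [projLeft_tmul, map_smul, ← map_counit_counit_comul b, TensorProduct.comul_tmul]
    generalize comul (R := k) a = s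
    generalize comul (R := k) b = t
    induction s with
    | zero => simp
    | add x y hx hy => simp only [TensorProduct.add_tmul, map_add, smul_add, hx, hy]
    | tmul a a' =>
      induction t with
      | zero => simp
      | add x y hx hy => simp only [TensorProduct.tmul_add, map_add, add_smul, hx, hy]
      | tmul b b' => simp [TensorProduct.smul_tmul', TensorProduct.tmul_smul, smul_smul, mul_comm]

/-- The mirror image: `phi` is reduced to ε(a) b ⊗ 1, which is again 1 on u. -/
theorem IsTwist.map_projRight_projRight {u : (A ⊗[k] B)ˣ} (hu : IsTwist u) (z : A ⊗[k] B) :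
    Algebra.TensorProduct.map (projRight k A B) (projRight k A B) (twistComul u z) =
      comul (R := k) (projRight k A B z) := by
  have e : mapUnit ((Algebra.TensorProduct.map (projRight k A B) (projRight k A B)).comp phi) u =
      1 := by
    apply Units.ext
    have : (Algebra.TensorProduct.map (projRight k A B) (projRight k A B)).comp phi =
        Algebra.TensorProduct.includeLeft.comp (projRight k A B) := by
      ext <;> simp [phi_tmul]
    rw [val_mapUnit, this, AlgHom.comp_apply, hu.projRight_val, map_one, Units.val_one]
  rw [map_comp_twistComul, e, Ad_one, AlgHom.id_apply]
  induction z with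
  | zero => simp
  | add x y hx hy => simp only [map_add, hx, hy]
  | tmul a b =>
    rw [projRight_tmul, map_smul, ← map_counit_counit_comul a, TensorProduct.comul_tmul]
    generalize comul (R := k) a = s
    generalize comul (R := k) b = t
    induction s with
    | zero => simp
    | add x y hx hy => simp only [TensorProduct.add_tmul, map_add, add_smul, hx, hy]
    | tmul a a' =>
      induction t with
      | zero => simp
      | add x y hx hy => simp only [TensorProduct.tmul_add, map_add, smul_add, hx, hy]
      | tmul b b' => simp [TensorProduct.smul_tmul', TensorProduct.tmul_smul, smul_smul, mul_comm]

/-- These projections kill both legs of `phi`, leaving the scalar (ε ⊗ ε)(u) = 1. The counit axioms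
then return z; this is why a coaction can be rebuilt from its two pushforwards. -/
theorem IsTwist.map_projLeft_projRight {u : (A ⊗[k] B)ˣ} (hu : IsTwist u) (z : A ⊗[k] B) :
    Algebra.TensorProduct.map (projLeft k A B) (projRight k A B) (twistComul u z) = z := by
  have e : mapUnit ((Algebra.TensorProduct.map (projLeft k A B) (projRight k A B)).comp phi) u =
      1 := by
    apply Units.ext
    have : (Algebra.TensorProduct.map (projLeft k A B) (projRight k A B)).comp phi =
        (Algebra.ofId k _).comp ((Bialgebra.counitAlgHom k B).comp (projRight k A B)) := by
      ext <;> simp [phi_tmul, Algebra.ofId_apply, Algebra.algebraMap_eq_smul_one,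
        Algebra.TensorProduct.one_def, TensorProduct.smul_tmul']
    rw [val_mapUnit, this, AlgHom.comp_apply, AlgHom.comp_apply, hu.projRight_val, map_one, map_one, Units.val_one]
  rw [map_comp_twistComul, e, Ad_one, AlgHom.id_apply]
  induction z with
  | zero => simp
  | add x y hx hy => simp only [map_add, hx, hy]
  | tmul a b =>
    have ha := congrArg (TensorProduct.rid k A) (Coalgebra.lTensor_counit_comul (R := k) a)
    have hb := congrArg (TensorProduct.lid k B) (Coalgebra.rTensor_counit_comul (R := k) b)
    simp only [TensorProduct.lid_tmul, TensorProduct.rid_tmul, one_smul] at ha hb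
    rw [TensorProduct.comul_tmul]
    conv_rhs => rw [← ha, ← hb]
    generalize comul (R := k) a = s
    generalize comul (R := k) b = t
    induction s with
    | zero => simp
    | add x y hx hy => simp only [TensorProduct.add_tmul, map_add, hx, hy]
    | tmul a a' =>
      induction t with
      | zero => simp
      | add x y hx hy => simp only [TensorProduct.tmul_add, map_add, hx, hy]
      | tmul b b' => simp [TensorProduct.smul_tmul', TensorProduct.tmul_smul, smul_smul, mul_comm]

theorem map_projRight_projLeft_comul (z : A ⊗[k] B) :
    Algebra.TensorProduct.map (projRight k A B) (projLeft k A B) (comul (R := k) z) =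
      TensorProduct.comm k A B z := by
  induction z with
  | zero => simp
  | add x y hx hy => simp only [map_add, hx, hy]
  | tmul a b =>
    have ha := congrArg (TensorProduct.lid k A) (Coalgebra.rTensor_counit_comul (R := k) a)
    have hb := congrArg (TensorProduct.rid k B) (Coalgebra.lTensor_counit_comul (R := k) b)
    simp only [TensorProduct.lid_tmul, TensorProduct.rid_tmul, one_smul] at ha hb
    rw [TensorProduct.comul_tmul]
    conv_rhs => rw [← ha, ← hb]
    generalize comul (R := k) a = s
    generalize comul (R := k) b = t
    induction s with
    | zero => simp
    | add x y hx hy => simp only [TensorProduct.add_tmul, map_add, hx, hy]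
    | tmul a a' =>
      induction t with
      | zero => simp
      | add x y hx hy => simp only [TensorProduct.tmul_add, map_add, hx, hy]
      | tmul b b' => simp [TensorProduct.smul_tmul', TensorProduct.tmul_smul, smul_smul, mul_comm]

/-- In this order the projections keep both legs of `phi`, whose composite with them is the flip.
The conjugation therefore survives, and it is the one in the Yetter-Drinfeld condition. -/
theorem map_projRight_projLeft (u : (A ⊗[k] B)ˣ) (z : A ⊗[k] B) :
    Algebra.TensorProduct.map (projRight k A B) (projLeft k A B) (twistComul u z) =
      TensorProduct.comm k A B (Ad (k := k) u z) := by
  have e : (Algebra.TensorProduct.map (projRight k A B) (projLeft k A B)).comp phi =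
      (Algebra.TensorProduct.comm k A B).toAlgHom := by
    ext <;> simp [phi_tmul]
  have h := DFunLike.congr_fun (comp_Ad (Algebra.TensorProduct.comm k A B).toAlgHom u) z
  rw [map_comp_twistComul, map_projRight_projLeft_comul, e]
  exact h.symm

end TwistedCoactions
end
end DY

namespace DY
open scoped TensorProduct
open Coalgebra
noncomputable section

/-! ### Two compatible coactions combine into one for the twisted coproduct. -/

section Combine
variable {k : Type u} [Field k] {A : Type*} {B : Type*} [Ring A] [Bialgebra k A] [Ring B]
  [Bialgebra k B] {X : Type*} [Ring X] [Algebra k X]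

/-- The map `(id ⊗ β) α`, with values in `(A ⊗ B) ⊗ X`. -/
def combine (α : X →ₐ[k] A ⊗[k] X) (β : X →ₐ[k] B ⊗[k] X) : X →ₗ[k] (A ⊗[k] B) ⊗[k] X :=
  (TensorProduct.assoc k A B X).symm.toLinearMap ∘ₗ β.toLinearMap.lTensor A ∘ₗ α.toLinearMap

theorem combine_apply (α : X →ₐ[k] A ⊗[k] X) (β : X →ₐ[k] B ⊗[k] X) (x : X) : combine α β x =
    (TensorProduct.assoc k A B X).symm (β.toLinearMap.lTensor A (α x)) := rfl

/-- The compatibility `(id ⊗ α) β = (Σ ⊗ id) (Ad(u) ⊗ id) (id ⊗ β) α`. -/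
def IsTwistedPair (u : (A ⊗[k] B)ˣ) (α : X →ₐ[k] A ⊗[k] X) (β : X →ₐ[k] B ⊗[k] X) : Prop :=
  ∀ x : X, α.toLinearMap.lTensor B (β x) =
    TensorProduct.assoc k B A X ((TensorProduct.comm k A B).toLinearMap.rTensor X
      ((Ad (k := k) u).toLinearMap.rTensor X (combine α β x)))

/-- Elements in the image of `mid` have 1 in the outer legs, so multiplying by them on either side
leaves a and b' untouched. -/
theorem Ad_mid (u : (A ⊗[k] B)ˣ) (a a' : A) (b b' : B) :
    Ad (k := k) (mapUnit (mid k A B) u) ((a ⊗ₜ a') ⊗ₜ (b ⊗ₜ b')) =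
      TensorProduct.map (TensorProduct.mk k A A a) ((TensorProduct.mk k B B).flip b')
        (Ad (k := k) u (a' ⊗ₜ b)) := by
  have h1 : ∀ z w : A ⊗[k] B, mid k A B z *
      TensorProduct.map (TensorProduct.mk k A A a) ((TensorProduct.mk k B B).flip b') w =
      TensorProduct.map (TensorProduct.mk k A A a) ((TensorProduct.mk k B B).flip b') (z * w) := by
    intro z w
    induction z with
    | zero => simp
    | add x y hx hy => simp only [map_add, add_mul, hx, hy]
    | tmul x y =>
      induction w with
      | zero => simp
      | add x y hx hy => simp only [map_add, mul_add, hx, hy]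
      | tmul c d => simp [mid]
  have h2 : ∀ z w : A ⊗[k] B,
      TensorProduct.map (TensorProduct.mk k A A a) ((TensorProduct.mk k B B).flip b') w *
        mid k A B z =
      TensorProduct.map (TensorProduct.mk k A A a) ((TensorProduct.mk k B B).flip b') (w * z) := by
    intro z w
    induction z with
    | zero => simp
    | add x y hx hy => simp only [map_add, mul_add, hx, hy]
    | tmul x y =>
      induction w with
      | zero => simp
      | add x y hx hy => simp only [map_add, add_mul, hx, hy]
      | tmul c d => simp [mid]
  rw [Ad_apply, Ad_apply, val_mapUnit, val_inv_mapUnit, ← h2, ← h1]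
  rfl

/-- The map `(c ⊗ b) ↦ (a ⊗ b) ⊗ (c ⊗ s)`. -/
def insertAt (a : A) (s : B ⊗[k] X) : A ⊗[k] B →ₗ[k] (A ⊗[k] B) ⊗[k] ((A ⊗[k] B) ⊗[k] X) :=
  TensorProduct.map (TensorProduct.mk k A B a)
    ((TensorProduct.assoc k A B X).symm.toLinearMap ∘ₗ
      (TensorProduct.mk k A (B ⊗[k] X)).flip s) ∘ₗ (TensorProduct.comm k A B).toLinearMap

@[simp] theorem insertAt_tmul (a c : A) (b : B) (s : B ⊗[k] X) : insertAt a s (c ⊗ₜ b) =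
    (a ⊗ₜ b) ⊗ₜ (TensorProduct.assoc k A B X).symm (c ⊗ₜ s) := rfl

theorem insertAt_zero (a : A) (w : A ⊗[k] B) : insertAt a (0 : B ⊗[k] X) w = 0 := by
  simp [insertAt]

theorem insertAt_add (a : A) (s t : B ⊗[k] X) (w : A ⊗[k] B) :
    insertAt a (s + t) w = insertAt a s w + insertAt a t w := by
  simp [insertAt, TensorProduct.map_add_right, LinearMap.comp_add, LinearMap.add_comp]

/-- The map `b ⊗ (c ⊗ x) ↦ (a ⊗ b) ⊗ (c ⊗ β x)`. -/
def applyRight (β : X →ₐ[k] B ⊗[k] X) (a : A) :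
    B ⊗[k] (A ⊗[k] X) →ₗ[k] (A ⊗[k] B) ⊗[k] ((A ⊗[k] B) ⊗[k] X) :=
  TensorProduct.map (TensorProduct.mk k A B a)
    ((TensorProduct.assoc k A B X).symm.toLinearMap ∘ₗ β.toLinearMap.lTensor A)

@[simp] theorem applyRight_tmul (β : X →ₐ[k] B ⊗[k] X) (a c : A) (b : B) (x : X) :
    applyRight β a (b ⊗ₜ (c ⊗ₜ x)) =
      (a ⊗ₜ b) ⊗ₜ (TensorProduct.assoc k A B X).symm (c ⊗ₜ β x) := rfl

theorem applyRight_comm (β : X →ₐ[k] B ⊗[k] X) (a : A) (w : A ⊗[k] B) (x : X) :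
    applyRight β a (TensorProduct.assoc k B A X (TensorProduct.comm k A B w ⊗ₜ x)) =
      insertAt a (β x) w := by
  induction w with
  | zero => simp
  | add x y hx hy => simp only [map_add, TensorProduct.add_tmul, hx, hy]
  | tmul c d => simp

/-- Isolates α applied after β inside (id ⊗ γ) γ: for t = β y, the argument of `applyRight` is the
left side of the compatibility condition. -/
theorem combine_lTensor (α : X →ₐ[k] A ⊗[k] X) (β : X →ₐ[k] B ⊗[k] X) (a : A) (t : B ⊗[k] X) :
    (combine α β).lTensor (A ⊗[k] B) ((TensorProduct.assoc k A B X).symm (a ⊗ₜ t)) =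
      applyRight β a (α.toLinearMap.lTensor B t) := by
  induction t with
  | zero => simp
  | add x y hx hy => simp only [TensorProduct.tmul_add, map_add, hx, hy]
  | tmul b v =>
    rw [TensorProduct.assoc_symm_tmul, LinearMap.lTensor_tmul, LinearMap.lTensor_tmul,
      combine_apply, AlgHom.toLinearMap_apply]
    generalize α v = z
    induction z with
    | zero => simp
    | add x y hx hy => simp only [TensorProduct.tmul_add, map_add, hx, hy]
    | tmul c v => simp

/-- The map `(id ⊗ Σ Ad(u) ⊗ id) ⊗ id`. -/
def twistMid (X : Type*) [Ring X] [Algebra k X] (u : (A ⊗[k] B)ˣ) :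
    ((A ⊗[k] A) ⊗[k] (B ⊗[k] B)) ⊗[k] X →ₗ[k] (A ⊗[k] B) ⊗[k] ((A ⊗[k] B) ⊗[k] X) :=
  (TensorProduct.assoc k _ _ X).toLinearMap ∘ₗ
    ((TensorProduct.tensorTensorTensorComm k A A B B).toLinearMap ∘ₗ
      (Ad (k := k) (mapUnit (mid k A B) u)).toLinearMap).rTensor X

theorem twistMid_tmul (u : (A ⊗[k] B)ˣ) (a a' : A) (b : B) (s : B ⊗[k] X) :
    twistMid X u ((TensorProduct.assoc k _ _ X).symm ((a ⊗ₜ a') ⊗ₜ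
      (TensorProduct.assoc k B B X).symm (b ⊗ₜ s))) = insertAt a s (Ad (k := k) u (a' ⊗ₜ b)) := by
  induction s with
  | zero => simp [insertAt_zero]
  | add x y hx hy => simp only [TensorProduct.tmul_add, map_add, hx, hy, insertAt_add]
  | tmul b' v =>
    simp only [twistMid, TensorProduct.assoc_symm_tmul, LinearMap.comp_apply,
      LinearMap.rTensor_tmul, AlgHom.toLinearMap_apply, LinearEquiv.coe_coe, Ad_mid]
    generalize Ad (k := k) u (a' ⊗ₜ b) = w
    induction w with
    | zero => simp
    | add x y hx hy => simp only [map_add, TensorProduct.add_tmul, hx, hy]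
    | tmul c d => simp

/-- The map `w ⊗ x ↦ w ⊗ (id ⊗ β) (β x)`. -/
def coactTwice (W : Type*) [AddCommGroup W] [Module k W] (β : X →ₐ[k] B ⊗[k] X) :
    W ⊗[k] X →ₗ[k] (W ⊗[k] (B ⊗[k] B)) ⊗[k] X :=
  (TensorProduct.assoc k _ _ X).symm.toLinearMap ∘ₗ
    ((TensorProduct.assoc k B B X).symm.toLinearMap ∘ₗ β.toLinearMap.lTensor B ∘ₗ
      β.toLinearMap).lTensor W

theorem coactTwice_tmul {W : Type*} [AddCommGroup W] [Module k W] (β : X →ₐ[k] B ⊗[k] X) (w : W)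
    (x : X) : coactTwice W β (w ⊗ₜ x) = (TensorProduct.assoc k _ _ X).symm
      (w ⊗ₜ (TensorProduct.assoc k B B X).symm (β.toLinearMap.lTensor B (β x))) := rfl

/-- Counterpart of `combine_lTensor` for the coproduct side: for z = α y, the argument of
`applyRight` is the right side of the compatibility condition. The second application of β only
touches the last B-leg and commutes with the conjugation. -/
theorem twistMid_coactTwice (u : (A ⊗[k] B)ˣ) (β : X →ₐ[k] B ⊗[k] X) (a : A) (z : A ⊗[k] X) :
    twistMid X u (coactTwice _ β ((TensorProduct.assoc k A A X).symm (a ⊗ₜ z))) =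
      applyRight β a (TensorProduct.assoc k B A X ((TensorProduct.comm k A B).toLinearMap.rTensor X
        ((Ad (k := k) u).toLinearMap.rTensor X
          ((TensorProduct.assoc k A B X).symm (β.toLinearMap.lTensor A z))))) := by
  induction z with
  | zero => simp
  | add x y hx hy => simp only [TensorProduct.tmul_add, map_add, hx, hy]
  | tmul a' v =>
    rw [TensorProduct.assoc_symm_tmul, coactTwice_tmul, LinearMap.lTensor_tmul,
      AlgHom.toLinearMap_apply]
    generalize β v = t
    induction t with
    | zero => simp
    | add x y hx hy => simp only [TensorProduct.tmul_add, map_add, hx, hy]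
    | tmul b v' =>
      rw [LinearMap.lTensor_tmul, twistMid_tmul, TensorProduct.assoc_symm_tmul,
        LinearMap.rTensor_tmul, LinearMap.rTensor_tmul, AlgHom.toLinearMap_apply,
        AlgHom.toLinearMap_apply, LinearEquiv.coe_coe, applyRight_comm]

/-- Coassociativity of β replaces the coproduct of B by a second application of β. -/
theorem rTensor_twistComul {β : X →ₐ[k] B ⊗[k] X} (hβ : IsLeftCoaction β) (u : (A ⊗[k] B)ˣ)
    (z : A ⊗[k] X) :
    TensorProduct.assoc k _ _ X ((twistComul u).toLinearMap.rTensor X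
      ((TensorProduct.assoc k A B X).symm (β.toLinearMap.lTensor A z))) =
      twistMid X u (coactTwice _ β ((comul (R := k) (A := A)).rTensor X z)) := by
  induction z with
  | zero => simp
  | add x y hx hy => simp only [map_add, hx, hy]
  | tmul a y =>
    rw [LinearMap.rTensor_tmul, coactTwice_tmul, LinearMap.lTensor_tmul, hβ.coassoc,
      LinearEquiv.symm_apply_apply, AlgHom.toLinearMap_apply]
    generalize β y = t
    induction t with
    | zero => simp
    | add x y hx hy => simp only [TensorProduct.tmul_add, map_add, hx, hy]
    | tmul b v => rfl

/-- Once coassociativity of α and β has removed the coproducts, each term a ⊗ y of α x contributes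
`applyRight β a` of one side of the compatibility condition at y on the left, and of the other side
on the right. -/
theorem combine_coassoc {u : (A ⊗[k] B)ˣ} {α : X →ₐ[k] A ⊗[k] X} {β : X →ₐ[k] B ⊗[k] X}
    (hα : IsLeftCoaction α) (hβ : IsLeftCoaction β) (h : IsTwistedPair u α β) (x : X) :
    (combine α β).lTensor (A ⊗[k] B) (combine α β x) =
      TensorProduct.assoc k _ _ X ((twistComul u).toLinearMap.rTensor X (combine α β x)) := by
  have hx : (comul (R := k) (A := A)).rTensor X (α x) =
      (TensorProduct.assoc k A A X).symm (α.toLinearMap.lTensor A (α x)) := by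
    rw [hα.coassoc, LinearEquiv.symm_apply_apply]
  rw [combine_apply, rTensor_twistComul hβ, hx]
  generalize α x = z
  induction z with
  | zero => simp
  | add x y hx hy => simp only [map_add, hx, hy]
  | tmul a y =>
    rw [LinearMap.lTensor_tmul, LinearMap.lTensor_tmul, combine_lTensor, AlgHom.toLinearMap_apply,
      AlgHom.toLinearMap_apply, twistMid_coactTwice, h y]
    rfl

theorem combine_counit {α : X →ₐ[k] A ⊗[k] X} {β : X →ₐ[k] B ⊗[k] X}
    (hβ : IsLeftCoaction β) (x : X) :
    (projLeft k A B).toLinearMap.rTensor X (combine α β x) = α x := by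
  rw [combine_apply]
  generalize α x = z
  induction z with
  | zero => simp
  | add x y hx hy => simp only [map_add, hx, hy]
  | tmul a y =>
    have h := hβ.counit_coact y
    rw [LinearMap.lTensor_tmul, AlgHom.toLinearMap_apply]
    conv_rhs => rw [← h]
    generalize β y = t
    induction t with
    | zero => simp
    | add x y hx hy => simp only [TensorProduct.tmul_add, map_add, hx, hy]
    | tmul b v => simp [TensorProduct.smul_tmul]

theorem combine_counit' {α : X →ₐ[k] A ⊗[k] X} {β : X →ₐ[k] B ⊗[k] X}
    (hα : IsLeftCoaction α) (x : X) :
    (projRight k A B).toLinearMap.rTensor X (combine α β x) = β x := by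
  rw [combine_apply]
  conv_rhs => rw [← hα.counit_coact x]
  generalize α x = z
  induction z with
  | zero => simp
  | add x y hx hy => simp only [map_add, hx, hy]
  | tmul a y =>
    rw [LinearMap.lTensor_tmul, AlgHom.toLinearMap_apply, LinearMap.rTensor_tmul,
      TensorProduct.lid_tmul, map_smul]
    generalize β y = t
    induction t with
    | zero => simp
    | add x y hx hy => simp only [TensorProduct.tmul_add, map_add, hx, hy, smul_add]
    | tmul b v => simp [TensorProduct.smul_tmul']

end Combine
end
end DY

namespace DY
open scoped TensorProduct
open Coalgebra
noncomputable section

/-! ### Pushing a coaction forward along algebra homomorphisms. -/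

section Pushforward
variable {k : Type u} [Field k] {T : Type*} {A : Type*} {B : Type*} [Ring T] [Bialgebra k T]
  [Ring A] [Bialgebra k A] [Ring B] [Bialgebra k B] {X : Type*} [Ring X] [Algebra k X]

theorem assoc_rTensor_map {M M' N N' : Type*} [AddCommGroup M] [Module k M] [AddCommGroup M']
    [Module k M'] [AddCommGroup N] [Module k N] [AddCommGroup N'] [Module k N'] (f : M →ₗ[k] M')
    (g : N →ₗ[k] N') (z : (M ⊗[k] N) ⊗[k] X) :
    TensorProduct.assoc k M' N' X ((TensorProduct.map f g).rTensor X z) =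
      TensorProduct.map f (g.rTensor X) (TensorProduct.assoc k M N X z) := by
  induction z with
  | zero => simp
  | add x y hx hy => simp only [map_add, hx, hy]
  | tmul w y =>
    induction w with
    | zero => simp
    | add x y hx hy => simp only [TensorProduct.add_tmul, map_add, hx, hy]
    | tmul s t => rfl

/-- The map `(π ⊗ id) γ`. -/
def pushCoact (π : T →ₐ[k] A) (γ : X →ₐ[k] T ⊗[k] X) : X →ₐ[k] A ⊗[k] X :=
  (Algebra.TensorProduct.map π (AlgHom.id k X)).comp γ

theorem pushCoact_apply (π : T →ₐ[k] A) (γ : X →ₐ[k] T ⊗[k] X) (x : X) :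
    pushCoact π γ x = π.toLinearMap.rTensor X (γ x) := rfl

/-- Coassociativity of γ: every identity for (π ⊗ σ) Δ becomes an identity between the pushed
coactions. Neither map need respect coproducts. -/
theorem pushCoact_pushCoact {γ : X →ₐ[k] T ⊗[k] X} (hγ : IsLeftCoaction γ) (π : T →ₐ[k] A)
    (σ : T →ₐ[k] B) (x : X) :
    (pushCoact σ γ).toLinearMap.lTensor A (pushCoact π γ x) = TensorProduct.assoc k A B X
      (((Algebra.TensorProduct.map π σ).toLinearMap ∘ₗ comul).rTensor X (γ x)) := by
  have h1 : ∀ z : T ⊗[k] X, (pushCoact σ γ).toLinearMap.lTensor A (π.toLinearMap.rTensor X z) =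
      TensorProduct.map π.toLinearMap (σ.toLinearMap.rTensor X) (γ.toLinearMap.lTensor T z) := by
    intro z
    induction z with
    | zero => simp
    | add x y hx hy => simp only [map_add, hx, hy]
    | tmul t y => rfl
  rw [pushCoact_apply, h1, hγ.coassoc, ← assoc_rTensor_map, LinearMap.rTensor_comp,
    LinearMap.comp_apply]
  rfl

theorem isLeftCoaction_pushCoact {γ : X →ₐ[k] T ⊗[k] X} (hγ : IsLeftCoaction γ) (π : T →ₐ[k] A)
    (h : ∀ t, Algebra.TensorProduct.map π π (comul (R := k) t) = comul (R := k) (π t))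
    (h' : ∀ t, counit (R := k) (π t) = counit (R := k) t) : IsLeftCoaction (pushCoact π γ) := by
  refine ⟨fun x => ?_, fun x => ?_⟩
  · rw [pushCoact_pushCoact hγ, pushCoact_apply, ← LinearMap.rTensor_comp_apply]
    congr 3
    ext t
    exact h t
  · rw [pushCoact_apply, ← LinearMap.rTensor_comp_apply]
    have : counit (R := k) ∘ₗ π.toLinearMap = counit := LinearMap.ext h'
    rw [this, hγ.counit_coact]

end Pushforward

/-! ### Coactions of the codouble, and the action of the double. -/

section CodoubleCoaction
variable {k : Type u} [Field k] {H : Type v} [Ring H] [HopfAlgebra k H] [FiniteDimensional k H]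
  {X : Type w} [Ring X] [Algebra k X]

theorem codouble_comul (t : Codouble k H) :
    comul (R := k) t = twistComul (opU k H) (Codouble.equiv k H t) := rfl

theorem gammaMap_apply (α : X →ₐ[k] Hᵐᵒᵖ ⊗[k] X) (β : X →ₐ[k] Dual k H ⊗[k] X) (x : X) :
    gammaMap α β x = (Codouble.equiv k H).symm.toLinearMap.rTensor X (combine α β x) := rfl

theorem isTwistedPair_iff (α : X →ₐ[k] Hᵐᵒᵖ ⊗[k] X) (β : X →ₐ[k] Dual k H ⊗[k] X) :
    IsTwistedPair (opU k H) α β ↔ IsLeftLeftYD α β := Iff.rfl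

theorem counit_combine {A : Type*} {B : Type*} [Ring A] [Bialgebra k A] [Ring B] [Bialgebra k B]
    {α : X →ₐ[k] A ⊗[k] X} {β : X →ₐ[k] B ⊗[k] X} (hα : IsLeftCoaction α) (hβ : IsLeftCoaction β)
    (x : X) : TensorProduct.lid k X ((counit (R := k)).rTensor X (combine α β x)) = x := by
  have h : counit (R := k) (A := A ⊗[k] B) = counit (R := k) ∘ₗ (projLeft k A B).toLinearMap := by
    ext; simp [mul_comm]
  rw [h, LinearMap.rTensor_comp, LinearMap.comp_apply, combine_counit hβ, hα.counit_coact]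

theorem isLeftCoaction_gammaMap {α : X →ₐ[k] Hᵐᵒᵖ ⊗[k] X} {β : X →ₐ[k] Dual k H ⊗[k] X}
    (hα : IsLeftCoaction α) (hβ : IsLeftCoaction β) (h : IsLeftLeftYD α β) :
    IsLeftCoaction (gammaMap α β) := by
  let e : Hᵐᵒᵖ ⊗[k] Dual k H →ₗ[k] Codouble k H := (Codouble.equiv k H).symm.toLinearMap
  have hγ : (gammaMap α β).toLinearMap = e.rTensor X ∘ₗ combine α β :=
    LinearMap.ext (gammaMap_apply α β)
  have he : comul (R := k) ∘ₗ e = TensorProduct.map e e ∘ₗ (twistComul (opU k H)).toLinearMap := by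
    refine LinearMap.ext fun z => ?_
    rw [LinearMap.comp_apply, LinearMap.comp_apply, codouble_comul]
    -- The map `e` is the identity on underlying spaces, so `TensorProduct.map e e` is one too.
    exact (DFunLike.congr_fun (TensorProduct.map_id (R := k)) _).symm
  have he' : counit (R := k) ∘ₗ e = counit (R := k) := rfl
  refine ⟨fun x => ?_, fun x => ?_⟩
  · rw [hγ, gammaMap_apply, ← LinearMap.rTensor_comp_apply, he, LinearMap.rTensor_comp_apply,
      assoc_rTensor_map, ← combine_coassoc hα hβ ((isTwistedPair_iff α β).2 h)]
    generalize combine α β x = z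
    induction z with
    | zero => simp
    | add x y hx hy => simp only [map_add, hx, hy]
    | tmul t y => rfl
  · rw [gammaMap_apply, ← LinearMap.rTensor_comp_apply, he', counit_combine hα hβ]

variable (k H) in
/-- The projection of the codouble onto `H^op`. -/
def codoubleLeft : Codouble k H →ₐ[k] Hᵐᵒᵖ :=
  (projLeft k Hᵐᵒᵖ (Dual k H)).comp (Codouble.equiv k H).toAlgHom

variable (k H) in
/-- The projection of the codouble onto `H^*`. -/
def codoubleRight : Codouble k H →ₐ[k] Dual k H :=
  (projRight k Hᵐᵒᵖ (Dual k H)).comp (Codouble.equiv k H).toAlgHom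

theorem counit_projLeft {A : Type*} {B : Type*} [Ring A] [Bialgebra k A] [Ring B] [Bialgebra k B]
    (z : A ⊗[k] B) : counit (R := k) (projLeft k A B z) = counit (R := k) z := by
  induction z with
  | zero => simp
  | add x y hx hy => simp only [map_add, hx, hy]
  | tmul a b => simp

theorem counit_projRight {A : Type*} {B : Type*} [Ring A] [Bialgebra k A] [Ring B] [Bialgebra k B]
    (z : A ⊗[k] B) : counit (R := k) (projRight k A B z) = counit (R := k) z := by
  induction z with
  | zero => simp
  | add x y hx hy => simp only [map_add, hx, hy]
  | tmul a b => simp [mul_comm]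

variable {γ : X →ₐ[k] Codouble k H ⊗[k] X}

theorem isLeftCoaction_codoubleLeft (hγ : IsLeftCoaction γ) :
    IsLeftCoaction (pushCoact (codoubleLeft k H) γ) :=
  isLeftCoaction_pushCoact hγ _ (fun t => (opU_isTwist k H).map_projLeft_projLeft t)
    fun _ => counit_projLeft _

theorem isLeftCoaction_codoubleRight (hγ : IsLeftCoaction γ) :
    IsLeftCoaction (pushCoact (codoubleRight k H) γ) :=
  isLeftCoaction_pushCoact hγ _ (fun t => (opU_isTwist k H).map_projRight_projRight t)
    fun _ => counit_projRight _

/-- Follows from (π_L ⊗ π_R) `Δ_T` = id. -/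
theorem combine_pushCoact (hγ : IsLeftCoaction γ) (x : X) :
    combine (pushCoact (codoubleLeft k H) γ) (pushCoact (codoubleRight k H) γ) x =
      (Codouble.equiv k H).toLinearMap.rTensor X (γ x) := by
  rw [combine_apply, pushCoact_pushCoact hγ, LinearEquiv.symm_apply_apply]
  congr 2
  ext t
  exact (opU_isTwist k H).map_projLeft_projRight t

theorem gammaMap_pushCoact (hγ : IsLeftCoaction γ) :
    gammaMap (pushCoact (codoubleLeft k H) γ) (pushCoact (codoubleRight k H) γ) = γ := by
  ext x
  rw [gammaMap_apply, combine_pushCoact hγ, ← LinearMap.comp_apply, ← LinearMap.rTensor_comp]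
  exact DFunLike.congr_fun (LinearMap.rTensor_id X (Codouble k H)) (γ x)

/-- The left side is governed by (π_R ⊗ π_L) `Δ_T` = Σ Ad(U); on the right, the combined coaction is
γ itself. -/
theorem isLeftLeftYD_pushCoact (hγ : IsLeftCoaction γ) :
    IsLeftLeftYD (pushCoact (codoubleLeft k H) γ) (pushCoact (codoubleRight k H) γ) := by
  refine (isTwistedPair_iff _ _).1 fun x => ?_
  rw [combine_pushCoact hγ, pushCoact_pushCoact hγ, ← LinearMap.comp_apply, ← LinearMap.comp_apply,
    ← LinearMap.rTensor_comp, ← LinearMap.rTensor_comp]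
  congr 3
  ext t
  exact map_projRight_projLeft (opU k H) t

theorem codoubleLeft_gammaMap (α : X →ₐ[k] Hᵐᵒᵖ ⊗[k] X) {β : X →ₐ[k] Dual k H ⊗[k] X}
    (hβ : IsLeftCoaction β) (x : X) :
    (codoubleLeft k H).toLinearMap.rTensor X (gammaMap α β x) = α x := by
  rw [← combine_counit (α := α) hβ, gammaMap_apply, ← LinearMap.comp_apply,
    ← LinearMap.rTensor_comp]
  rfl

theorem codoubleRight_gammaMap {α : X →ₐ[k] Hᵐᵒᵖ ⊗[k] X} (β : X →ₐ[k] Dual k H ⊗[k] X)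
    (hα : IsLeftCoaction α) (x : X) :
    (codoubleRight k H).toLinearMap.rTensor X (gammaMap α β x) = β x := by
  rw [← combine_counit' (β := β) hα, gammaMap_apply, ← LinearMap.comp_apply,
    ← LinearMap.rTensor_comp]
  rfl

theorem actβ_eq (β : X →ₐ[k] Dual k H ⊗[k] X) :
    actβ β = contract (evFlip k H).toLinearMap β := by
  rw [actβ, toLinearMap_evFlip]

/-- It suffices to test on ω ⋈ h, whose pairing with op c ⊗ θ factors as ω(c) θ(h): contracting γ is
contracting α with ω and then β with h. No coaction axiom is involved. -/
theorem radfordAct_actβ (α : X →ₐ[k] Hᵐᵒᵖ ⊗[k] X) (β : X →ₐ[k] Dual k H ⊗[k] X) :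
    radfordAct (actβ β) α = actγ (gammaMap α β) := by
  ext x d
  obtain ⟨z, rfl⟩ := (bowtie k H).surjective d
  induction z with
  | zero => simp
  | add a b ha hb => simp only [map_add, ha, hb]
  | tmul ω h =>
    rw [radfordAct_bowtie, actγ, actβ, actα, contract_apply, contract_apply, contract_apply,
      gammaMap_apply, combine_apply]
    generalize α x = z
    induction z with
    | zero => simp
    | add a b ha hb => simp only [map_add, ha, hb]
    | tmul a y =>
      simp only [LinearMap.rTensor_tmul, TensorProduct.lid_tmul, map_smul, LinearMap.lTensor_tmul,
        AlgHom.toLinearMap_apply]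
      generalize β y = t
      induction t with
      | zero => simp
      | add a b ha hb => simp only [map_add, TensorProduct.tmul_add, smul_add, ha, hb]
      | tmul θ v =>
        simp only [TensorProduct.assoc_symm_tmul, LinearMap.rTensor_tmul, TensorProduct.lid_tmul,
          LinearEquiv.coe_coe]
        have := ev_bowtie ω θ h a.unop
        rw [MulOpposite.op_unop] at this
        erw [this]
        simp [smul_smul]

end CodoubleCoaction
end
end DY

namespace DY
open scoped TensorProduct
open Coalgebra
noncomputable section

/-! ### The four equivalences and the commutative square. -/

section Equivalences
variable {k : Type u} [Field k] {H : Type v} [Ring H] [HopfAlgebra k H] [FiniteDimensional k H]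

theorem isLeftCoaction_gammaMap_of_leftLeftYDAlg (M : LeftLeftYDAlg.{u, v, w} k H) :
    IsLeftCoaction (gammaMap M.coactα M.coactβ) :=
  isLeftCoaction_gammaMap M.isCoactionα M.isCoactionβ M.isYD

theorem actβ_of_leftLeftYDAlg (M : LeftLeftYDAlg.{u, v, w} k H) :
    IsRightModuleAlgebra (actβ M.coactβ) ∧ IsRightLeftYD (actβ M.coactβ) M.coactα := by
  rw [actβ_eq]
  exact ⟨((isPerfectPairing_evFlip k H).isRightModuleAlgebra_contract_iff _).2 M.isCoactionβ,
    (isLeftLeftYD_iff _ _).1 M.isYD⟩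

theorem isRightModuleAlgebra_actγ (N : LeftComodAlg.{u, max u v, w} k (Codouble k H)) :
    IsRightModuleAlgebra (actγ N.coact) :=
  ((isPerfectPairing_ev k (Codouble k H)).isRightModuleAlgebra_contract_iff _).2 N.isCoaction

/-- The action of H dualizes to β on the same algebra, so the preimage is strict and not merely up
to isomorphism. This allows properties to be transferred by substitution. -/
theorem exists_leftLeftYDAlg_eq (Y : RightLeftYDAlg.{u, v, w} k H) :
    ∃ M : LeftLeftYDAlg.{u, v, w} k H, (toRightLeftYD actβ_of_leftLeftYDAlg).obj M = Y := by
  obtain ⟨X, ρ, α, hρ, hα, hY⟩ := Y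
  obtain ⟨β, rfl⟩ := (isPerfectPairing_evFlip k H).exists_contract_eq hρ
  refine ⟨⟨X, α, β, hα, ((isPerfectPairing_evFlip k H).isRightModuleAlgebra_contract_iff _).1 hρ,
    (isLeftLeftYD_iff α β).2 hY⟩, ?_⟩
  simp only [toRightLeftYD, actβ_eq]

/-- Once Y comes from a left-left algebra, the action is dual to a coaction of the codouble, and the
product of the double never has to be computed. -/
theorem isRightModuleAlgebra_radfordAct (Y : RightLeftYDAlg.{u, v, w} k H) :
    IsRightModuleAlgebra (radfordAct Y.act Y.coact) := by
  obtain ⟨M, rfl⟩ := exists_leftLeftYDAlg_eq Y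
  change IsRightModuleAlgebra (radfordAct (actβ M.coactβ) M.coactα)
  rw [radfordAct_actβ]
  exact isRightModuleAlgebra_actγ ⟨M.carrier, _, isLeftCoaction_gammaMap_of_leftLeftYDAlg M⟩

theorem toRightLeftYD_isEquivalence :
    (toRightLeftYD.{u, v, w} (k := k) (H := H) actβ_of_leftLeftYDAlg).IsEquivalence where
  faithful := ⟨fun {_ _ f g} h => LeftLeftYDAlg.Hom.ext (congrArg RightLeftYDAlg.Hom.toAlgHom h)⟩
  full := ⟨fun {M N} f => ⟨⟨f.toAlgHom, f.map_coact,
    map_coact_of_map_contract (p := evFlip k H) f.toAlgHom fun x h => by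
      have := f.map_act x h
      simp only [toRightLeftYD, actβ_eq] at this
      exact this⟩, rfl⟩⟩
  essSurj := ⟨fun Y => by
    obtain ⟨M, hM⟩ := exists_leftLeftYDAlg_eq Y
    exact ⟨M, ⟨CategoryTheory.eqToIso hM⟩⟩⟩

/-- Both coactions are projections of γ, and the projections act on the T-leg while f acts on the
X-leg, so they commute. This gives fullness. -/
theorem map_coact_of_map_gammaMap {X Y : Type*} [Ring X] [Algebra k X] [Ring Y] [Algebra k Y]
    {α : X →ₐ[k] Hᵐᵒᵖ ⊗[k] X} {β : X →ₐ[k] Dual k H ⊗[k] X} {α' : Y →ₐ[k] Hᵐᵒᵖ ⊗[k] Y}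
    {β' : Y →ₐ[k] Dual k H ⊗[k] Y} (hα : IsLeftCoaction α) (hβ : IsLeftCoaction β)
    (hα' : IsLeftCoaction α') (hβ' : IsLeftCoaction β') (f : X →ₐ[k] Y)
    (hf : ∀ x, gammaMap α' β' (f x) = f.toLinearMap.lTensor (Codouble k H) (gammaMap α β x)) :
    (∀ x, α' (f x) = f.toLinearMap.lTensor Hᵐᵒᵖ (α x)) ∧
      ∀ x, β' (f x) = f.toLinearMap.lTensor (Dual k H) (β x) := by
  refine ⟨fun x => ?_, fun x => ?_⟩
  · rw [← codoubleLeft_gammaMap α' hβ', ← codoubleLeft_gammaMap α hβ, hf, ← LinearMap.comp_apply,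
      ← LinearMap.comp_apply, LinearMap.rTensor_comp_lTensor, LinearMap.lTensor_comp_rTensor]
  · rw [← codoubleRight_gammaMap β' hα', ← codoubleRight_gammaMap β hα, hf, ← LinearMap.comp_apply,
      ← LinearMap.comp_apply, LinearMap.rTensor_comp_lTensor, LinearMap.lTensor_comp_rTensor]

theorem toComodAlg_isEquivalence : (toComodAlg.{u, v, w} (k := k) (H := H)
    isLeftCoaction_gammaMap_of_leftLeftYDAlg).IsEquivalence where
  faithful := ⟨fun {_ _ f g} h => LeftLeftYDAlg.Hom.ext (congrArg LeftComodAlg.Hom.toAlgHom h)⟩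
  full := ⟨fun {M N} f => by
    have hf := map_coact_of_map_gammaMap M.isCoactionα M.isCoactionβ N.isCoactionα N.isCoactionβ
      f.toAlgHom f.map_coact
    exact ⟨⟨f.toAlgHom, hf.1, hf.2⟩, rfl⟩⟩
  essSurj := ⟨fun N => by
    obtain ⟨X, γ, hγ⟩ := N
    refine ⟨⟨X, _, _, isLeftCoaction_codoubleLeft hγ, isLeftCoaction_codoubleRight hγ,
      isLeftLeftYD_pushCoact hγ⟩, ⟨CategoryTheory.eqToIso ?_⟩⟩
    simp only [toComodAlg, gammaMap_pushCoact hγ]⟩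

theorem toRightModAlg_isEquivalence : (toRightModAlg.{u, v, w} (k := k) (H := H)
    isRightModuleAlgebra_actγ).IsEquivalence where
  faithful := ⟨fun {_ _ f g} h => LeftComodAlg.Hom.ext (congrArg RightModAlg.Hom.toAlgHom h)⟩
  full := ⟨fun {M N} f => ⟨⟨f.toAlgHom,
    map_coact_of_map_contract (p := ev k (Codouble k H)) f.toAlgHom f.map_act⟩, rfl⟩⟩
  essSurj := ⟨fun Y => by
    obtain ⟨X, ρ, hρ⟩ := Y
    obtain ⟨γ, rfl⟩ := (isPerfectPairing_ev k (Codouble k H)).exists_contract_eq hρ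
    exact ⟨⟨X, γ, ((isPerfectPairing_ev k (Codouble k H)).isRightModuleAlgebra_contract_iff γ).1
      hρ⟩, ⟨CategoryTheory.Iso.refl _⟩⟩⟩

/-- The functor from left-left Yetter-Drinfeld algebras to right module algebras over the double
attached to a natural family of actions, `f ↦ f` on morphisms. -/
def actFunctor (ρ : ∀ M : LeftLeftYDAlg.{u, v, w} k H,
      M.carrier →ₗ[k] Double k H →ₗ[k] M.carrier)
    (h : ∀ M, IsRightModuleAlgebra (ρ M))
    (hf : ∀ {M N : LeftLeftYDAlg.{u, v, w} k H} (f : M ⟶ N) (x : M.carrier) (d : Double k H),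
      LeftLeftYDAlg.Hom.toAlgHom f (ρ M x d) = ρ N (LeftLeftYDAlg.Hom.toAlgHom f x) d) :
    CategoryTheory.Functor (LeftLeftYDAlg.{u, v, w} k H)
      (RightModAlg.{u, max u v, w} k (Double k H)) where
  obj M := ⟨M.carrier, ρ M, h M⟩
  map f := ⟨LeftLeftYDAlg.Hom.toAlgHom f, hf f⟩

open scoped CategoryTheory in
theorem toRightLeftYD_comp_radfordFunctor :
    toRightLeftYD.{u, v, w} (k := k) (H := H) actβ_of_leftLeftYDAlg ⋙
      radfordFunctor isRightModuleAlgebra_radfordAct =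
    toComodAlg isLeftCoaction_gammaMap_of_leftLeftYDAlg ⋙
      toRightModAlg isRightModuleAlgebra_actγ := by
  -- The composites have the same carriers and underlying maps and differ only in the action. With
  -- the family of actions as a variable, their equality can be substituted without transporting
  -- morphisms along equalities of objects.
  have key : ∀ (ρ σ : ∀ M : LeftLeftYDAlg.{u, v, w} k H,
      M.carrier →ₗ[k] Double k H →ₗ[k] M.carrier) (h h' hf hf'), ρ = σ →
      actFunctor ρ h hf = actFunctor σ h' hf' := by
    rintro ρ _ h h' hf hf' rfl
    rfl
  exact key (fun M => radfordAct (actβ M.coactβ) M.coactα)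
    (fun M => actγ (gammaMap M.coactα M.coactβ))
    (fun M => isRightModuleAlgebra_radfordAct ((toRightLeftYD actβ_of_leftLeftYDAlg).obj M))
    (fun M => isRightModuleAlgebra_actγ
      ((toComodAlg isLeftCoaction_gammaMap_of_leftLeftYDAlg).obj M))
    (fun f => ((toRightLeftYD actβ_of_leftLeftYDAlg ⋙
      radfordFunctor isRightModuleAlgebra_radfordAct).map f).map_act)
    (fun f => ((toComodAlg isLeftCoaction_gammaMap_of_leftLeftYDAlg ⋙
      toRightModAlg isRightModuleAlgebra_actγ).map f).map_act)
    (funext fun M => radfordAct_actβ _ _)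

/-- Two out of three: the square exhibits its composite with an equivalence as a composite of two
equivalences. -/
theorem radfordFunctor_isEquivalence : (radfordFunctor.{u, v, w} (k := k) (H := H)
    isRightModuleAlgebra_radfordAct).IsEquivalence := by
  have h₁ := toComodAlg_isEquivalence.{u, v, w} (k := k) (H := H)
  have h₂ := toRightLeftYD_isEquivalence.{u, v, w} (k := k) (H := H)
  have h₃ := toRightModAlg_isEquivalence.{u, v, w} (k := k) (H := H)
  have h := CategoryTheory.Functor.isEquivalence_trans
    (toComodAlg.{u, v, w} (k := k) (H := H) isLeftCoaction_gammaMap_of_leftLeftYDAlg)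
    (toRightModAlg isRightModuleAlgebra_actγ)
  rw [← toRightLeftYD_comp_radfordFunctor] at h
  exact CategoryTheory.Functor.isEquivalence_of_comp_left
    (toRightLeftYD.{u, v, w} (k := k) (H := H) actβ_of_leftLeftYDAlg) _

end Equivalences
end
end DY

open scoped CategoryTheory
theorem mainTheorem10 {k : Type u} [Field k] {H : Type v} [Ring H] [HopfAlgebra k H]
    [FiniteDimensional k H] :
    ∃ (h₁ : ∀ M : DY.LeftLeftYDAlg.{u, v, w} k H,
        DY.IsLeftCoaction (DY.gammaMap M.coactα M.coactβ))
      (h₂ : ∀ M : DY.LeftLeftYDAlg.{u, v, w} k H,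
        DY.IsRightModuleAlgebra (DY.actβ M.coactβ) ∧
          DY.IsRightLeftYD (DY.actβ M.coactβ) M.coactα)
      (h₃ : ∀ N : DY.LeftComodAlg.{u, max u v, w} k (DY.Codouble k H),
        DY.IsRightModuleAlgebra (DY.actγ N.coact))
      (h₄ : ∀ Y : DY.RightLeftYDAlg.{u, v, w} k H,
        DY.IsRightModuleAlgebra (DY.radfordAct Y.act Y.coact)),
      (DY.toComodAlg h₁).IsEquivalence ∧
      (DY.toRightLeftYD h₂).IsEquivalence ∧
      (DY.toRightModAlg h₃).IsEquivalence ∧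
      (DY.radfordFunctor h₄).IsEquivalence ∧
      DY.toRightLeftYD h₂ ⋙ DY.radfordFunctor h₄ = DY.toComodAlg h₁ ⋙ DY.toRightModAlg h₃ :=
  ⟨DY.isLeftCoaction_gammaMap_of_leftLeftYDAlg, DY.actβ_of_leftLeftYDAlg,
    DY.isRightModuleAlgebra_actγ, DY.isRightModuleAlgebra_radfordAct,
    DY.toComodAlg_isEquivalence, DY.toRightLeftYD_isEquivalence, DY.toRightModAlg_isEquivalence,
    DY.radfordFunctor_isEquivalence, DY.toRightLeftYD_comp_radfordFunctor⟩
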